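/- **Setting.** Fix $L>0$, $N\ge1$ and points $0<x_1^-<x_1^+<x_2^-<\dots<x_N^+<L$, and extend them by $x_{p+N}^\pm=x_p^\pm+L$ to $p\in\mathbb Z$. For $m\in\mathbb Z$, $1\le i\le N$ let $D_i^m=(x_i^-+mL,\,x_i^++mL)$, $D_i=D_i^0$, $D=\bigcup_{m,i}D_i^m$, $\ell_i=x_i^+-x_i^-$. Write $w|_\pm(x)=\lim_{h\downarrow0}w(x\pm h)$. The unperturbed structure has parameters $\kappa_0,\rho_0,\kappa_{\rm r}^i,\rho_{\rm r}^i>0$ and contrast $\delta>0$; the spatially defected structure has densities $\rho_{\rm r}^{m,i}>0$ in $D_i^m$ and contrasts $\delta^m>0$. Put $v_0^2=\kappa_0/\rho_0$, $(v_i)^2=\kappa_{\rm r}^i/\rho_{\rm r}^i$, $(v_i^m)^2=\kappa_{\rm r}^i/\rho_{\rm r}^{m,i}$, and define $b_i^m$ by $\delta^m(v_i^m)^2=\delta(v_i)^2b_i^m$, $B^m=\mathrm{diag}(b_i^m)_i$. The modulations $\kappa_i(t),s_i(t)$ are real and non-vanishing, $1/\kappa_i$ and $1/s_i$ being of the form $\sum_{|n|\le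 M}c_n e^{in\Omega t}$, $\Omega>0$; $S=\mathrm{diag}(s_i)_i$, $K=\mathrm{diag}(\kappa_i)_i$. A classical solution $u(x,t)$ of the wave system is a complex function which is $C^2$ up to the boundary on every resonator and every gap between neighbouring resonators (times $\mathbb R_t$) and satisfies $$\partial_t^2u-v_0^2\partial_x^2u=0\ (x\notin\overline D),\qquad \partial_t\Big(\tfrac1{\kappa_i}\partial_tu\Big)-(v_i^m)^2\partial_x^2u=0\ (x\in D_i^m),$$ $$u|_\pm(x_i^\pm+mL,t)=\tfrac1{s_i(t)}u|_\mp(x_i^\pm+mL,t),\qquad \delta^m\,\partial_xu|_\pm(x_i^\pm+mL,t)=\tfrac1{s_i(t)}\,\partial_xu|_\mp(x_i^\pm+mL,t).$$ It has quasifrequency $\omega\in\mathbb C$ if $u(x,t)e^{-i\omega t}$ is $2\pi/\Omega$-periodic in $t$; its modes are $v_n(x)=\frac{\Omega}{2\pi}\int_0^{2\pi/\Omega}u(x,t)e^{-i(\omega+n\Omega)t}\,dt$. It is localised if all $v_n\in L^2(\mathbb R)$. Set $\|u\|_*=\sum_n\|v_n\|_{L^2(\mathbb R)}$, $$v_{i,n}^m=\frac1{\ell_i}\int_{D_i^m}v_n\,dx,\qquad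 \mathbf v_n^m=(v_{i,n}^m)_{i=1}^N,\qquad \mathbf v^m(t)=\sum_{k\in\mathbb Z}\mathbf v_k^m e^{i(\omega+k\Omega)t}.$$ **Capacitance matrices.** For $\alpha\in\mathbb R$ let $V_j^\alpha:\mathbb R\to\mathbb C$ be the continuous function with $(V_j^\alpha)''=0$ off $\overline D$, $V_j^\alpha=\delta_{ij}$ on $D_i$ and $V_j^\alpha(x+mL)=e^{i\alpha mL}V_j^\alpha(x)$. Let $$C_{ij}^\alpha=\frac{dV_j^\alpha}{dx}\Big|_-(x_i^-)-\frac{dV_j^\alpha}{dx}\Big|_+(x_i^+),\quad \mathcal C_{ij}^\alpha=\frac{\delta\kappa_{\rm r}^i}{\rho_{\rm r}^i\ell_i}C_{ij}^\alpha,\quad \mathcal C^m=\frac{L}{2\pi}\int_{-\pi/L}^{\pi/L}\mathcal C^\alpha e^{-i\alpha mL}\,d\alpha .$$ **Regime.** Let $\Lambda>0$, $\gamma\in(0,1)$. Assume $0<\delta<1$ and that, for all $m,i,t$: $v_0\ge\Lambda^{-1}$; $\Lambda^{-1}\le v_i^m\le\Lambda$; $\delta^m\le\Lambda\delta$; $\Omega\le\Lambda\delta^{1/2}$;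 $M\le\Lambda\delta^{-\gamma/2}$; $|s_i(t)|,|1/s_i(t)|,|1/\kappa_i(t)|\le\Lambda$. A localised solution $u$ with quasifrequency $\omega$ is called subwavelength if $|\omega|\le\Lambda\delta^{1/2}$, $\sum_n(1+|\omega+n\Omega|^2)\|v_n\|_{L^2(\mathbb R)}<\infty$ and $$\sum_{|n|>M}(1+|\omega+n\Omega|^2)\|v_n\|_{L^2(\mathbb R)}\le\Lambda\,\delta^{(1-\gamma)/2}\,\|u\|_* .$$ **Proposition.** There is a constant $A>0$, depending only on $N,L,(x_i^\pm),\Lambda,\gamma$, such that every localised subwavelength solution $u$ of the wave system in the spatially defected, time-periodic structure satisfies the following. For every $m\in\mathbb Z$ the series for $\mathbf v^m$ converges absolutely to a $C^2$ function, and for all $t\in\mathbb R$ and $x\in D_i^m$ $$|u(x,t)-v_i^m(t)|\le A\,\delta^{(1-\gamma)/2}e^{-\mathrm{Im}(\omega)t}\|u\|_* .$$ As $\delta\to0$, $u$ satisfies at leading order the real-space capacitance equation $$B^m\sum_{n\in\mathbb Z}\mathcal C^{\,n-m}\big(S^{-1}(t)\mathbf v^n(t)\big)=-\,S^{-1}(t)\frac{d}{dt}\Big(K^{-1}(t)\frac{d}{dt}\mathbf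 v^m(t)\Big)\qquad\text{for every } m\in\mathbb Z ,$$ that is, for all $m$ and $t$ the difference of the two sides is at most $A\,\delta^{1+(1-\gamma)/2}e^{-\mathrm{Im}(\omega)t}\|u\|_*$ in the maximum norm. Equivalently, with $B=\mathrm{diag}(B^m)_m$, $\mathcal S=\mathrm{diag}(S)_m$, $\mathcal K=\mathrm{diag}(K)_m$, $\mathbf v=(\mathbf v^m)_m$ and the infinite block Toeplitz matrix $\mathcal C$ whose block in row $m$, column $n$ is $\mathcal C^{\,n-m}$, $$B\,\mathcal C\,\mathcal S^{-1}\mathbf v=-\,\mathcal S^{-1}\frac{d}{dt}\Big(\mathcal K^{-1}\frac{d}{dt}\mathbf v\Big)$$ at leading order: for all $t$ the difference of the two sides belongs to $\ell^2(\mathbb Z)^N$, with norm at most $A\,\delta^{1+(1-\gamma)/2}e^{-\mathrm{Im}(\omega)t}\|u\|_*$. -/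

import Mathlib

open scoped Topology Matrix

noncomputable section

/-- One-sided limit `w|₋(x)` from the left. -/
def traceLeft (w : ℝ → ℂ) (x : ℝ) : ℂ := Filter.limUnder (𝓝[<] x) w

/-- One-sided limit `w|₊(x)` from the right. -/
def traceRight (w : ℝ → ℂ) (x : ℝ) : ℂ := Filter.limUnder (𝓝[>] x) w

/-- The functional `I[f] = f'|₋(a) - f'|₊(b)` attached to the interval `(a, b)`. -/
def boundaryFlux (a b : ℝ) (f : ℝ → ℂ) : ℂ :=
  traceLeft (deriv f) a - traceRight (deriv f) b

/-- A periodic array of resonators with `N` resonators per unit cell `(0, L)`.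
The `p`-th resonator (`p : ℤ`) is `(xm p, xp p)`; the resonators of the central cell are
`p = 0, …, N - 1`. -/
structure ResonatorArray (N : ℕ) where
  L : ℝ
  xm : ℤ → ℝ
  xp : ℤ → ℝ
  N_pos : 0 < N
  L_pos : 0 < L
  lt_resonator : ∀ p, xm p < xp p
  lt_gap : ∀ p, xp p < xm (p + 1)
  xm_periodic : ∀ p, xm (p + N) = xm p + L
  xp_periodic : ∀ p, xp (p + N) = xp p + L
  first_in_cell : 0 < xm 0
  last_in_cell : xp ((N : ℤ) - 1) < L

/-- Index, in the two-sided sequence, of the `i`-th resonator of the `m`-th cell. -/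
def resIndex {N : ℕ} (m : ℤ) (i : Fin N) : ℤ := m * (N : ℤ) + (i : ℤ)

namespace ResonatorArray

variable {N : ℕ} (G : ResonatorArray N)

/-- Left end point of `D_i^m`. -/
def left (m : ℤ) (i : Fin N) : ℝ := G.xm (resIndex m i)

/-- Right end point of `D_i^m`. -/
def right (m : ℤ) (i : Fin N) : ℝ := G.xp (resIndex m i)

/-- Length `ℓ_i` of `D_i`. -/
def len (i : Fin N) : ℝ := G.right 0 i - G.left 0 i

/-- `V` solves the `α`-quasiperiodic problem that defines `V_j^α`: it is continuous, harmonic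
outside the resonators, equal to `δ_{ij}` on `D_i`, and `α`-quasiperiodic. -/
structure IsPotential (α : ℝ) (j : Fin N) (V : ℝ → ℂ) : Prop where
  cont : Continuous V
  smooth : ∀ p : ℤ, ContDiffOn ℝ 2 V (Set.Ioo (G.xp p) (G.xm (p + 1)))
  harmonic : ∀ p : ℤ, ∀ x ∈ Set.Ioo (G.xp p) (G.xm (p + 1)), -iteratedDeriv 2 V x = 0
  on_resonator : ∀ i : Fin N, ∀ x ∈ Set.Ioo (G.left 0 i) (G.right 0 i),
    V x = if i = j then 1 else 0
  quasiperiodic : ∀ (m : ℤ) (x : ℝ),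
    V (x + m * G.L) = Complex.exp (Complex.I * α * m * G.L) * V x

/-- The function `V_j^α` (the unique solution of the problem above). -/
def potential (α : ℝ) (j : Fin N) : ℝ → ℂ := Classical.epsilon (G.IsPotential α j)

/-- The quasiperiodic capacitance matrix `C^α`, `C_ij^α = I_{∂D_i}[V_j^α]`. -/
def capMatrix (α : ℝ) : Matrix (Fin N) (Fin N) ℂ :=
  Matrix.of fun i j => boundaryFlux (G.left 0 i) (G.right 0 i) (G.potential α j)

end ResonatorArray

/-- Inverse Floquet–Bloch transform of a function of `α`, at the lattice point `m L`. -/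
def invFloquet (L : ℝ) (F : ℝ → ℂ) (m : ℤ) : ℂ :=
  (L / (2 * Real.pi) : ℝ) *
    ∫ α in (-(Real.pi / L))..(Real.pi / L), F α * Complex.exp (-(Complex.I * α * (m * L)))

/-- Material parameters of the spatially defected structure: background `κ₀, ρ₀`; parameters
`κ_r^i, ρ_r^i` and contrast `δ` of the unperturbed structure; densities `ρ_r^{m,i}` and contrasts
`δ^m` of the defected one; time modulations `κ_i(t)`, `s_i(t)` with frequency `Ω`. -/
structure Medium (N : ℕ) where
  κ₀ : ℝ
  ρ₀ : ℝ
  κr : Fin N → ℝ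
  ρr : Fin N → ℝ
  δ : ℝ
  ρd : ℤ → Fin N → ℝ
  δd : ℤ → ℝ
  Ω : ℝ
  κ : Fin N → ℝ → ℝ
  s : Fin N → ℝ → ℝ
  κ₀_pos : 0 < κ₀
  ρ₀_pos : 0 < ρ₀
  κr_pos : ∀ i, 0 < κr i
  ρr_pos : ∀ i, 0 < ρr i
  δ_pos : 0 < δ
  ρd_pos : ∀ m i, 0 < ρd m i
  δd_pos : ∀ m, 0 < δd m
  Ω_pos : 0 < Ω
  κ_ne : ∀ i t, κ i t ≠ 0
  s_ne : ∀ i t, s i t ≠ 0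

/-- `f` is a trigonometric polynomial `∑_{|n| ≤ M} c_n e^{i n Ω t}`. -/
def IsTrigPoly (Ω : ℝ) (M : ℕ) (f : ℝ → ℝ) : Prop :=
  ∃ c : ℤ → ℂ, ∀ t : ℝ,
    (f t : ℂ) = ∑ n ∈ Finset.Icc (-(M : ℤ)) M, c n * Complex.exp (Complex.I * n * Ω * t)

namespace Medium

variable {N : ℕ} (P : Medium N)

/-- Background wave speed `v₀`. -/
def v₀ : ℝ := √(P.κ₀ / P.ρ₀)

/-- Wave speed `v_i` in the `i`-th resonator of the unperturbed structure. -/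
def vr (i : Fin N) : ℝ := √(P.κr i / P.ρr i)

/-- Wave speed `v_i^m` in `D_i^m` in the defected structure. -/
def vd (m : ℤ) (i : Fin N) : ℝ := √(P.κr i / P.ρd m i)

/-- The ratio `b_i^m`, given by `δ^m (v_i^m)² = δ (v_i)² b_i^m`. -/
def b (m : ℤ) (i : Fin N) : ℝ := (P.δd m * P.vd m i ^ 2) / (P.δ * P.vr i ^ 2)

/-- `B^m = diag (b_i^m)_i`. -/
def B (m : ℤ) : Matrix (Fin N) (Fin N) ℂ := Matrix.diagonal fun i => (P.b m i : ℂ)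

/-- `S(t) = diag (s_i(t))_i`. -/
def S (t : ℝ) : Matrix (Fin N) (Fin N) ℂ := Matrix.diagonal fun i => (P.s i t : ℂ)

/-- `K(t) = diag (κ_i(t))_i`. -/
def K (t : ℝ) : Matrix (Fin N) (Fin N) ℂ := Matrix.diagonal fun i => (P.κ i t : ℂ)

/-- The generalised capacitance matrix: row `i` of `C^α` is multiplied by
`δ κ_r^i / (ρ_r^i ℓ_i)`. -/
def genCapMatrix (G : ResonatorArray N) (α : ℝ) : Matrix (Fin N) (Fin N) ℂ :=
  Matrix.of fun i j => ((P.δ * P.κr i / P.ρr i / G.len i : ℝ) : ℂ) * G.capMatrix α i j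

/-- The real-space generalised capacitance matrix `𝒞^m`, the inverse Floquet–Bloch transform
of `𝒞^α` at the cell `m`. -/
def realCap (G : ResonatorArray N) (m : ℤ) : Matrix (Fin N) (Fin N) ℂ :=
  Matrix.of fun i j => invFloquet G.L (fun α => P.genCapMatrix G α i j) m

/-- Standing asymptotic regime with constants `Λ`, `γ`: wave speeds of order one, `δ^m = O(δ)`,
`Ω = O(δ^{1/2})`, modulations bounded, with inverses that are trigonometric polynomials of
degree `M = O(δ^{-γ/2})`. -/
structure InRegime (Λ γ : ℝ) (M : ℕ) : Prop where
  v₀_lower : Λ⁻¹ ≤ P.v₀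
  vd_lower : ∀ m i, Λ⁻¹ ≤ P.vd m i
  vd_upper : ∀ m i, P.vd m i ≤ Λ
  δd_upper : ∀ m, P.δd m ≤ Λ * P.δ
  Ω_upper : P.Ω ≤ Λ * √P.δ
  M_upper : (M : ℝ) ≤ Λ * P.δ ^ (-γ / 2)
  s_upper : ∀ i t, |P.s i t| ≤ Λ
  s_lower : ∀ i t, |1 / P.s i t| ≤ Λ
  κ_lower : ∀ i t, |1 / P.κ i t| ≤ Λ
  s_trig : ∀ i, IsTrigPoly P.Ω M (fun t => 1 / P.s i t)
  κ_trig : ∀ i, IsTrigPoly P.Ω M (fun t => 1 / P.κ i t)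

end Medium

/-- `u(x, t)` is of class `C²` for `x ∈ (a, b)`, `t ∈ ℝ`, up to the boundary `x = a, b`. -/
def IsC2UpTo (u : ℝ → ℝ → ℂ) (a b : ℝ) : Prop :=
  ∃ U : ℝ × ℝ → ℂ, ContDiff ℝ 2 U ∧ ∀ x ∈ Set.Ioo a b, ∀ t, u x t = U (x, t)

/-- Classical solutions of the wave system in the spatially defected, time-modulated structure. -/
structure IsWaveSolution {N : ℕ} (G : ResonatorArray N) (P : Medium N) (u : ℝ → ℝ → ℂ) :
    Prop where
  smooth_gap : ∀ p : ℤ, IsC2UpTo u (G.xp p) (G.xm (p + 1))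
  smooth_resonator : ∀ p : ℤ, IsC2UpTo u (G.xm p) (G.xp p)
  exterior : ∀ p : ℤ, ∀ x ∈ Set.Ioo (G.xp p) (G.xm (p + 1)), ∀ t : ℝ,
    iteratedDeriv 2 (fun τ => u x τ) t - (P.v₀ : ℂ) ^ 2 * iteratedDeriv 2 (fun y => u y t) x = 0
  interior : ∀ (m : ℤ) (i : Fin N), ∀ x ∈ Set.Ioo (G.left m i) (G.right m i), ∀ t : ℝ,
    deriv (fun τ => (1 / P.κ i τ : ℂ) * deriv (fun τ' => u x τ') τ) t
      - (P.vd m i : ℂ) ^ 2 * iteratedDeriv 2 (fun y => u y t) x = 0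
  trace_left : ∀ (m : ℤ) (i : Fin N) (t : ℝ),
    traceLeft (fun y => u y t) (G.left m i)
      = (1 / P.s i t : ℂ) * traceRight (fun y => u y t) (G.left m i)
  trace_right : ∀ (m : ℤ) (i : Fin N) (t : ℝ),
    traceRight (fun y => u y t) (G.right m i)
      = (1 / P.s i t : ℂ) * traceLeft (fun y => u y t) (G.right m i)
  flux_left : ∀ (m : ℤ) (i : Fin N) (t : ℝ),
    (P.δd m : ℂ) * traceLeft (deriv fun y => u y t) (G.left m i)
      = (1 / P.s i t : ℂ) * traceRight (deriv fun y => u y t) (G.left m i)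
  flux_right : ∀ (m : ℤ) (i : Fin N) (t : ℝ),
    (P.δd m : ℂ) * traceRight (deriv fun y => u y t) (G.right m i)
      = (1 / P.s i t : ℂ) * traceLeft (deriv fun y => u y t) (G.right m i)

/-- The frequency `ω + n Ω` of the `n`-th harmonic. -/
def freq (ω : ℂ) (Ω : ℝ) (n : ℤ) : ℂ := ω + n * Ω

/-- `u` has quasifrequency `ω`: `u(x,t) e^{-iωt}` is periodic in `t` with period `2π/Ω`. -/
def HasQuasifrequency (ω : ℂ) (Ω : ℝ) (u : ℝ → ℝ → ℂ) : Prop :=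
  ∀ x : ℝ, Function.Periodic (fun t : ℝ => u x t * Complex.exp (-(Complex.I * ω * t)))
    (2 * Real.pi / Ω)

/-- The `n`-th mode `v_n(x)` in `u(x,t) = e^{iωt} ∑ₙ v_n(x) e^{inΩt}`. -/
def mode (ω : ℂ) (Ω : ℝ) (u : ℝ → ℝ → ℂ) (n : ℤ) (x : ℝ) : ℂ :=
  (Ω / (2 * Real.pi) : ℝ) *
    ∫ t in (0 : ℝ)..(2 * Real.pi / Ω), u x t * Complex.exp (-(Complex.I * freq ω Ω n * t))

/-- The norm of `v_n` in `L²(ℝ)`. -/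
def modeNorm (ω : ℂ) (Ω : ℝ) (u : ℝ → ℝ → ℂ) (n : ℤ) : ℝ :=
  (MeasureTheory.eLpNorm (mode ω Ω u n) 2 MeasureTheory.volume).toReal

/-- The size `∑ₙ ‖v_n‖` of a localised solution. -/
def totalNorm (ω : ℂ) (Ω : ℝ) (u : ℝ → ℝ → ℂ) : ℝ := ∑' n : ℤ, modeNorm ω Ω u n

/-- `u` is localised: all its modes belong to `L²(ℝ)`. -/
def IsLocalised (ω : ℂ) (Ω : ℝ) (u : ℝ → ℝ → ℂ) : Prop :=
  ∀ n : ℤ, MeasureTheory.MemLp (mode ω Ω u n) 2 MeasureTheory.volume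

/-- `ω` is subwavelength, `ω = O(δ^{1/2})`, and `u` is supported in the low-frequency regime:
up to a relative error `O(δ^{(1-γ)/2})`, `u`, `∂ₜu` and `∂ₜ²u` are carried by the
harmonics `|n| ≤ M`. -/
structure IsSubwavelength (Λ γ δ : ℝ) (M : ℕ) (ω : ℂ) (Ω : ℝ) (u : ℝ → ℝ → ℂ) : Prop where
  ω_upper : ‖ω‖ ≤ Λ * √δ
  summable : Summable fun n : ℤ => (1 + ‖freq ω Ω n‖ ^ 2) * modeNorm ω Ω u n
  tail : (∑' n : ℤ, if (M : ℤ) < |n| then (1 + ‖freq ω Ω n‖ ^ 2) * modeNorm ω Ω u n else 0)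
    ≤ Λ * δ ^ ((1 - γ) / 2) * totalNorm ω Ω u

/-- The vector `𝐯_n^m`: its `i`-th entry is the mean value of `v_n` on `D_i^m`. -/
def modeVec {N : ℕ} (G : ResonatorArray N) (ω : ℂ) (Ω : ℝ) (u : ℝ → ℝ → ℂ) (n m : ℤ) :
    Fin N → ℂ :=
  fun i => ((G.len i)⁻¹ : ℝ) * ∫ x in (G.left m i)..(G.right m i), mode ω Ω u n x

/-- The vector `𝐯^m(t) = ∑ₖ 𝐯_k^m e^{i(ω+kΩ)t}`. -/
def cellVec {N : ℕ} (G : ResonatorArray N) (ω : ℂ) (Ω : ℝ) (u : ℝ → ℝ → ℂ) (m : ℤ) (t : ℝ) :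
    Fin N → ℂ :=
  fun i => ∑' k : ℤ, modeVec G ω Ω u k m i * Complex.exp (Complex.I * freq ω Ω k * t)

/-- The difference of the two sides of the capacitance equation in the cell `m`:
`B^m ∑ₙ 𝒞^{n-m} (S⁻¹ 𝐯^n) + S⁻¹ d/dt (K⁻¹ d/dt 𝐯^m)`. -/
def cellDefect {N : ℕ} (G : ResonatorArray N) (P : Medium N) (v : ℤ → ℝ → Fin N → ℂ)
    (m : ℤ) (t : ℝ) : Fin N → ℂ :=
  P.B m *ᵥ (∑' n : ℤ, P.realCap G (n - m) *ᵥ ((P.S t)⁻¹ *ᵥ v n t))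
    + (P.S t)⁻¹ *ᵥ deriv (fun τ => (P.K τ)⁻¹ *ᵥ deriv (v m) τ) t

/-- Action of an infinite matrix on an infinite vector. -/
def infMulVec {N : ℕ} (A : Matrix (ℤ × Fin N) (ℤ × Fin N) ℂ) (w : ℤ × Fin N → ℂ) :
    ℤ × Fin N → ℂ :=
  fun p => ∑' q : ℤ × Fin N, A p q * w q

/-- The block-diagonal infinite matrix with diagonal blocks `A m`. -/
def blockDiag {N : ℕ} (A : ℤ → Matrix (Fin N) (Fin N) ℂ) :
    Matrix (ℤ × Fin N) (ℤ × Fin N) ℂ :=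
  Matrix.of fun p q => if p.1 = q.1 then A p.1 p.2 q.2 else 0

/-- The infinite block Toeplitz matrix whose block in row `m` and column `n` is `A (n - m)`. -/
def blockToeplitz {N : ℕ} (A : ℤ → Matrix (Fin N) (Fin N) ℂ) :
    Matrix (ℤ × Fin N) (ℤ × Fin N) ℂ :=
  Matrix.of fun p q => A (q.1 - p.1) p.2 q.2

/-- The difference `B 𝒞 𝒮⁻¹ 𝐯 + 𝒮⁻¹ d/dt (𝒦⁻¹ d/dt 𝐯)` of the two sides of the capacitance
equation in infinite-matrix form; time derivatives are taken entrywise. -/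
def infDefect {N : ℕ} (G : ResonatorArray N) (P : Medium N) (v : ℝ → ℤ × Fin N → ℂ) (t : ℝ) :
    ℤ × Fin N → ℂ :=
  infMulVec (blockDiag P.B) (infMulVec (blockToeplitz (P.realCap G))
      (infMulVec (blockDiag fun _ => (P.S t)⁻¹) (v t)))
    + infMulVec (blockDiag fun _ => (P.S t)⁻¹) (fun q =>
        deriv (fun τ => infMulVec (blockDiag fun _ => (P.K τ)⁻¹)
          (fun r => deriv (fun τ' => v τ' r) τ) q) t)

end

/-! Write η = δ^((1-γ)/2). Everything is controlled by one square-integrable function, the majorant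
h(x) = Σ_n (η + |ω+nΩ|²) |v_n(x)|. For |n| ≤ M the frequencies are O(η), because MΩ = O(δ^(-γ/2)
δ^(1/2)); the remaining harmonics are covered by the tail hypothesis. Hence the L² norm of h is O(η
‖u‖_*) (`weighted_tsum_le`, `lintegral_majorant_sq_le`). Up to the factor e^(-Im(ω)t), h dominates
η|u|, η|∂ₜu| and |∂ₜ²u|. The integrals of h over the intervals (x_q^+, x_(q+1)^+], each made of one
gap and the resonator after it, form a square-summable sequence of local masses of ℓ² size O(η
‖u‖_*).

The wave equations turn these bounds into bounds of ∂ₓ²u in L¹ of each gap and each resonator. In a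
resonator the term (1/κ)' ∂ₜu is harmless, since Bernstein's inequality gives (1/κ)' = O(η). In a
gap ∂ₓu is close to a difference quotient, and η ∂ₓu is bounded by interpolation between u and ∂ₓ²u.
The flux condition carries ∂ₓu into the resonator with a factor δ^m = O(δ) = O(η). So ∂ₓu is bounded
there by the mass, and u is close to its mean (`norm_resExt_sub_mean_le`). By Fourier inversion this
mean is the entry of 𝐯^m (`cellVec_eq_mean`).

Each V_j^α is affine on gaps, so after the inverse Floquet transform the operator 𝒞 is exactly a
weighted nearest-neighbour Laplacian on the chain of resonators (`hasSum_realCap`). Integrating the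
interior equation over a resonator expresses the time derivative term by the two exterior fluxes
(`deriv_flux_eq`). The defect is thus a coefficient of order δ times the error made in replacing
these fluxes by difference quotients of the means divided by s_i (`rowDefect_eq`,
`norm_scaledMean_slope_le`). That error is bounded by three consecutive masses, which gives both the
bound in each cell and the ℓ² bound. -/

open scoped Topology Matrix

noncomputable section

/-! ### Fourier series of quasiperiodic functions of time. -/

/-- The `n`-th Fourier coefficient of `h(t) e^{-iωt}` on `[0, 2π/Ω]`. -/
def timeCoeff (ω : ℂ) (Ω : ℝ) (h : ℝ → ℂ) (n : ℤ) : ℂ :=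
  (Ω / (2 * Real.pi) : ℝ) *
    ∫ t in (0 : ℝ)..(2 * Real.pi / Ω), h t * Complex.exp (-(Complex.I * freq ω Ω n * t))

/-- `h(t) e^{-iωt}` is periodic with period `2π/Ω`. -/
abbrev QuasiPeriodic (ω : ℂ) (Ω : ℝ) (h : ℝ → ℂ) : Prop :=
  Function.Periodic (fun t : ℝ => h t * Complex.exp (-(Complex.I * ω * t))) (2 * Real.pi / Ω)

lemma norm_exp_freq (ω : ℂ) (Ω : ℝ) (n : ℤ) (t : ℝ) :
    ‖Complex.exp (Complex.I * freq ω Ω n * t)‖ = Real.exp (-(ω.im * t)) := by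
  rw [Complex.norm_exp]
  congr 1
  simp [freq]

/-- The multiplier form of quasiperiodicity passes at once to time derivatives and to averages in x,
which is how it is used below. -/
lemma QuasiPeriodic.shift {ω : ℂ} {Ω : ℝ} {h : ℝ → ℂ} (hp : QuasiPeriodic ω Ω h) (t : ℝ) :
    h (t + 2 * Real.pi / Ω) = Complex.exp (Complex.I * ω * (2 * Real.pi / Ω : ℝ)) * h t := by
  have h1 := hp t
  simp only at h1
  have h2 : Complex.exp (-(Complex.I * ω * t)) =
      Complex.exp (Complex.I * ω * (2 * Real.pi / Ω : ℝ)) *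
        Complex.exp (-(Complex.I * ω * ((t + 2 * Real.pi / Ω : ℝ) : ℂ))) := by
    rw [← Complex.exp_add]; congr 1; push_cast; ring
  rw [h2, ← mul_assoc] at h1
  have h3 := mul_right_cancel₀ (Complex.exp_ne_zero _) h1
  rw [h3]; ring

lemma quasiPeriodic_of_shift {ω : ℂ} {Ω : ℝ} {h : ℝ → ℂ}
    (hs : ∀ t, h (t + 2 * Real.pi / Ω) =
      Complex.exp (Complex.I * ω * (2 * Real.pi / Ω : ℝ)) * h t) : QuasiPeriodic ω Ω h := by
  intro t
  simp only
  rw [hs t]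
  have h2 : Complex.exp (-(Complex.I * ω * t)) =
      Complex.exp (Complex.I * ω * (2 * Real.pi / Ω : ℝ)) *
        Complex.exp (-(Complex.I * ω * ((t + 2 * Real.pi / Ω : ℝ) : ℂ))) := by
    rw [← Complex.exp_add]; congr 1; push_cast; ring
  rw [h2]; ring

lemma QuasiPeriodic.deriv {ω : ℂ} {Ω : ℝ} {h : ℝ → ℂ} (hp : QuasiPeriodic ω Ω h) :
    QuasiPeriodic ω Ω (deriv h) := by
  apply quasiPeriodic_of_shift
  intro t
  rw [← deriv_comp_add_const, funext hp.shift, deriv_const_mul_field]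

lemma fourierCoeff_lift {ω : ℂ} {Ω : ℝ} (hΩ : 0 < Ω) {h : ℝ → ℂ} (hp : QuasiPeriodic ω Ω h)
    [Fact (0 < 2 * Real.pi / Ω)] (n : ℤ) :
    fourierCoeff (T := 2 * Real.pi / Ω) (Function.Periodic.lift hp) n = timeCoeff ω Ω h n := by
  rw [fourierCoeff_eq_intervalIntegral _ n 0, timeCoeff, zero_add]
  rw [Complex.real_smul]
  congr 1
  · push_cast; field_simp
  · apply intervalIntegral.integral_congr
    intro t _
    simp only [Function.Periodic.lift_coe, fourier_coe_apply, smul_eq_mul]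
    rw [mul_comm, mul_assoc, ← Complex.exp_add]
    congr 2
    have : (Real.pi : ℂ) ≠ 0 := by exact_mod_cast Real.pi_ne_zero
    have : (Ω : ℂ) ≠ 0 := by exact_mod_cast hΩ.ne'
    simp only [freq]
    push_cast
    field_simp
    ring

/-- A continuous quasiperiodic function is the sum of its Fourier series when the coefficients
are absolutely summable. -/
lemma hasSum_timeCoeff {ω : ℂ} {Ω : ℝ} (hΩ : 0 < Ω) {h : ℝ → ℂ} (hp : QuasiPeriodic ω Ω h)
    (hc : Continuous h) (hs : Summable (timeCoeff ω Ω h)) (t : ℝ) :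
    HasSum (fun n => timeCoeff ω Ω h n * Complex.exp (Complex.I * freq ω Ω n * t)) (h t) := by
  have : Fact (0 < 2 * Real.pi / Ω) := ⟨by positivity⟩
  have hcont : Continuous (Function.Periodic.lift hp) := by
    apply continuous_coinduced_dom.mpr
    have : (Function.Periodic.lift hp ∘ fun x : ℝ => (x : AddCircle (2 * Real.pi / Ω))) =
      fun t : ℝ => h t * Complex.exp (-(Complex.I * ω * t)) := by
      ext x; simp [Function.Periodic.lift_coe]
    change Continuous (Function.Periodic.lift hp ∘ fun x : ℝ => (x : AddCircle (2 * Real.pi / Ω)))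
    rw [this]
    fun_prop
  have key := has_pointwise_sum_fourier_series_of_summable
    (f := (⟨_, hcont⟩ : C(AddCircle (2 * Real.pi / Ω), ℂ)))
    (by simpa only [ContinuousMap.coe_mk, funext (fourierCoeff_lift hΩ hp)] using hs)
    (t : AddCircle (2 * Real.pi / Ω))
  have h2 := key.mul_right (Complex.exp (Complex.I * ω * t))
  simp only [ContinuousMap.coe_mk, fourierCoeff_lift hΩ hp, Function.Periodic.lift_coe,
    smul_eq_mul, fourier_coe_apply] at h2
  rw [mul_assoc (h t), ← Complex.exp_add] at h2
  simp only [neg_add_cancel, Complex.exp_zero, mul_one] at h2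
  refine Eq.mp (congrArg (HasSum · (h t)) (funext fun n => ?_)) h2
  rw [mul_assoc, ← Complex.exp_add]
  congr 2
  have : (Real.pi : ℂ) ≠ 0 := by exact_mod_cast Real.pi_ne_zero
  have : (Ω : ℂ) ≠ 0 := by exact_mod_cast hΩ.ne'
  simp only [freq]
  push_cast
  field_simp
  ring

/-- With values in `ENNReal` the bound is trivial when the coefficients are not summable. This
matters because the L² hypotheses control the modes only for almost every x, while the bound is
needed at every x. -/
lemma enorm_le_tsum_timeCoeff {ω : ℂ} {Ω : ℝ} (hΩ : 0 < Ω) {h : ℝ → ℂ}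
    (hp : QuasiPeriodic ω Ω h) (hc : Continuous h) (t : ℝ) :
    ‖h t‖ₑ ≤ ENNReal.ofReal (Real.exp (-(ω.im * t))) * ∑' n, ‖timeCoeff ω Ω h n‖ₑ := by
  by_cases hfin : ∑' n, ‖timeCoeff ω Ω h n‖ₑ = ⊤
  · rw [hfin, ENNReal.mul_top (by simpa using Real.exp_pos _)]
    exact le_top
  have hs : Summable fun n => ‖timeCoeff ω Ω h n‖ := tsum_enorm_ne_top_iff_summable_norm.1 hfin
  have h1 := hasSum_timeCoeff hΩ hp hc hs.of_norm t
  rw [← h1.tsum_eq, ← ENNReal.tsum_mul_left]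
  refine enorm_tsum_le_tsum_enorm.trans (ENNReal.tsum_le_tsum fun n => ?_)
  rw [enorm_mul, mul_comm, ← norm_exp_freq ω Ω n t, ofReal_norm]

lemma hasDerivAt_cexp_mul (a : ℂ) (t : ℝ) :
    HasDerivAt (fun s : ℝ => Complex.exp (a * s)) (a * Complex.exp (a * t)) t := by
  have h1 : HasDerivAt (fun s : ℝ => a * (s : ℂ)) a t := by
    simpa using (Complex.ofRealCLM.hasDerivAt (x := t)).const_mul a
  simpa [mul_comm] using h1.cexp

/-- Integration by parts over one period. The boundary terms cancel because the multiplier of h is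
undone by the exponential, n periods of e^(iΩt) contributing only the factor e^(-2πin) = 1. -/
lemma timeCoeff_deriv {ω : ℂ} {Ω : ℝ} (hΩ : 0 < Ω) {h : ℝ → ℂ}
    (hp : QuasiPeriodic ω Ω h) (hc : ContDiff ℝ 1 h) (n : ℤ) :
    timeCoeff ω Ω (deriv h) n = Complex.I * freq ω Ω n * timeCoeff ω Ω h n := by
  have hd : Differentiable ℝ h := hc.differentiable one_ne_zero
  have hE : ∀ t : ℝ, HasDerivAt (fun t : ℝ => Complex.exp (-(Complex.I * freq ω Ω n * t)))
      (-(Complex.I * freq ω Ω n) * Complex.exp (-(Complex.I * freq ω Ω n * t))) t := by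
    intro t
    simpa only [neg_mul] using hasDerivAt_cexp_mul (-(Complex.I * freq ω Ω n)) t
  have hcd : Continuous (deriv h) := hc.continuous_deriv le_rfl
  have h0 := intervalIntegral.integral_deriv_mul_eq_sub (a := 0) (b := 2 * Real.pi / Ω)
    (fun t _ => (hd t).hasDerivAt) (fun t _ => hE t)
    (hcd.intervalIntegrable _ _) (Continuous.intervalIntegrable (by fun_prop) _ _)
  have hend : h (2 * Real.pi / Ω) *
      Complex.exp (-(Complex.I * freq ω Ω n * ((2 * Real.pi / Ω : ℝ) : ℂ))) =
      h 0 * Complex.exp (-(Complex.I * freq ω Ω n * ((0 : ℝ) : ℂ))) := by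
    have := hp.shift 0
    rw [zero_add] at this
    have hpi : (Ω : ℂ) ≠ 0 := by exact_mod_cast hΩ.ne'
    have e : Complex.exp (-(Complex.I * freq ω Ω n * ((2 * Real.pi / Ω : ℝ) : ℂ))) =
        Complex.exp (-(Complex.I * ω * ((2 * Real.pi / Ω : ℝ) : ℂ))) := by
      rw [Complex.exp_eq_exp_iff_exists_int]
      refine ⟨-n, ?_⟩
      simp only [freq]
      push_cast
      field_simp
      ring
    rw [this, e]
    simp [mul_right_comm, ← Complex.exp_add]
  rw [hend, sub_self, intervalIntegral.integral_add
    (Continuous.intervalIntegrable (by fun_prop) _ _)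
    (Continuous.intervalIntegrable (by have := hc.continuous; fun_prop) _ _)] at h0
  have h3 : (∫ t in (0 : ℝ)..(2 * Real.pi / Ω), h t * (-(Complex.I * freq ω Ω n) *
      Complex.exp (-(Complex.I * freq ω Ω n * t)))) = -(Complex.I * freq ω Ω n) *
      ∫ t in (0 : ℝ)..(2 * Real.pi / Ω), h t * Complex.exp (-(Complex.I * freq ω Ω n * t)) := by
    rw [← intervalIntegral.integral_const_mul]
    congr 1; ext t; ring
  rw [h3] at h0
  simp only [timeCoeff]
  linear_combination ((Ω / (2 * Real.pi) : ℝ) : ℂ) * h0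

/-! ### Bernstein's inequality. -/

/-- Bernstein's inequality, with a non-optimal constant: the derivative of a trigonometric
polynomial of degree `M` and frequency `Ω` is bounded by a multiple of `M Ω` times its supremum. -/
lemma norm_deriv_trigPoly_le {Ω : ℝ} (hΩ : 0 < Ω) {M : ℕ} {c : ℤ → ℂ} {f : ℝ → ℂ} {K : ℝ}
    (hf : ∀ t : ℝ, f t = ∑ n ∈ Finset.Icc (-(M : ℤ)) M, c n * Complex.exp (Complex.I * n * Ω * t))
    (hK : ∀ t, ‖f t‖ ≤ K) (t : ℝ) :
    ‖deriv f t‖ ≤ (Real.exp 2 + 1) * (M * Ω * K) := by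
  -- With w = e^(iΩt), p(w) = w^M f(t) has degree at most 2M, and q is the reversed polynomial, p(w)
  -- = w^(2M) q(1/w). The maximum principle for p bounds p inside the unit disc, and for q it bounds
  -- p outside.
  set p : ℂ → ℂ := fun w => ∑ n ∈ Finset.Icc (-(M : ℤ)) M, c n * w ^ (n + M).toNat with hp
  set q : ℂ → ℂ := fun w => ∑ n ∈ Finset.Icc (-(M : ℤ)) M, c n * w ^ (M - n).toNat with hq
  have hK0 : 0 ≤ K := (norm_nonneg _).trans (hK 0)
  have hpd : Differentiable ℂ p := by fun_prop
  have hqd : Differentiable ℂ q := by fun_prop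
  have pf : ∀ s : ℝ, p (Complex.exp (Complex.I * Ω * s)) =
      Complex.exp (Complex.I * Ω * s) ^ M * f s := by
    intro s
    rw [hf, Finset.mul_sum]
    refine Finset.sum_congr rfl fun n hn => ?_
    rw [Finset.mem_Icc] at hn
    rw [mul_left_comm, ← Complex.exp_nat_mul, ← Complex.exp_nat_mul, ← Complex.exp_add]
    congr 2
    have : (((n + M).toNat : ℕ) : ℂ) = n + M := by
      have : (((n + M).toNat : ℕ) : ℤ) = n + M := Int.toNat_of_nonneg (by omega)
      exact_mod_cast congrArg (Int.cast : ℤ → ℂ) this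
    rw [this]; ring
  have pq : ∀ w : ℂ, w ≠ 0 → p w = w ^ (2 * M) * q w⁻¹ := by
    intro w hw
    simp only [hp, hq]
    rw [Finset.mul_sum]
    refine Finset.sum_congr rfl fun n hn => ?_
    rw [Finset.mem_Icc] at hn
    rw [mul_left_comm]
    congr 1
    have h2 : 2 * M = (n + M).toNat + (M - n).toNat := by omega
    rw [h2, pow_add, mul_assoc, ← mul_pow, mul_inv_cancel₀ hw, one_pow, mul_one]
  have arg : ∀ w : ℂ, ‖w‖ = 1 → ∃ s : ℝ, w = Complex.exp (Complex.I * Ω * s) := by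
    intro w hw
    refine ⟨Complex.arg w / Ω, ?_⟩
    have := Complex.norm_mul_exp_arg_mul_I w
    rw [hw] at this
    simp only [Complex.ofReal_one, one_mul] at this
    rw [← this]
    congr 1
    have hpi : (Ω : ℂ) ≠ 0 := by exact_mod_cast hΩ.ne'
    rw [this]
    push_cast
    field_simp
  have nexp : ∀ s : ℝ, ‖Complex.exp (Complex.I * Ω * s)‖ = 1 := by
    intro s
    rw [Complex.norm_exp]; simp
  have p1 : ∀ w : ℂ, ‖w‖ = 1 → ‖p w‖ ≤ K := by
    intro w hw
    obtain ⟨s, rfl⟩ := arg w hw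
    rw [pf, norm_mul, norm_pow, hw, one_pow, one_mul]
    exact hK s
  have q1 : ∀ w : ℂ, ‖w‖ = 1 → ‖q w‖ ≤ K := by
    intro w hw
    have hw0 : w ≠ 0 := by rintro rfl; simp at hw
    have := p1 w⁻¹ (by rw [norm_inv, hw, inv_one])
    rwa [pq _ (inv_ne_zero hw0), norm_mul, norm_pow, norm_inv, hw, inv_one, one_pow, one_mul,
      inv_inv] at this
  have disc : ∀ g : ℂ → ℂ, Differentiable ℂ g → (∀ w : ℂ, ‖w‖ = 1 → ‖g w‖ ≤ K) →
      ∀ w : ℂ, ‖w‖ ≤ 1 → ‖g w‖ ≤ K := by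
    intro g hg h1 w hw
    refine Complex.norm_le_of_forall_mem_frontier_norm_le (U := Metric.ball 0 1)
      Metric.isBounded_ball hg.diffContOnCl ?_ ?_
    · intro z hz
      rw [frontier_ball (0 : ℂ) one_ne_zero] at hz
      exact h1 z (by simpa using hz)
    · rw [closure_ball (0 : ℂ) one_ne_zero]; simpa using hw
  have pout : ∀ (w : ℂ) (r : ℝ), 1 ≤ r → ‖w‖ ≤ r → ‖p w‖ ≤ r ^ (2 * M) * K := by
    intro w r hr hwr
    have hr1 : (1 : ℝ) ≤ r ^ (2 * M) := one_le_pow₀ hr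
    rcases le_total ‖w‖ 1 with hw | hw
    · calc ‖p w‖ ≤ K := disc p hpd p1 w hw
        _ ≤ _ := le_mul_of_one_le_left hK0 hr1
    · have hw0 : w ≠ 0 := by rintro rfl; norm_num at hw
      rw [pq w hw0, norm_mul, norm_pow]
      gcongr
      exact disc q hqd q1 _ (by rw [norm_inv]; exact inv_le_one_of_one_le₀ hw)
  have dp : ∀ w : ℂ, ‖w‖ = 1 → ‖deriv p w‖ ≤ M * (Real.exp 2 * K) := by
    intro w hw
    rcases Nat.eq_zero_or_pos M with rfl | hM
    · have : p = fun _ => c 0 := by ext z; simp [hp]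
      simp [this]
    have hM' : (0 : ℝ) < M := by exact_mod_cast hM
    -- Cauchy's estimate on the circle of radius 1/M about w: there |p| ≤ (1 + 1/M)^(2M) K ≤ e² K.
    -- The case M = 0, where p is constant, was set apart to have a radius.
    have := Complex.norm_deriv_le_of_forall_mem_sphere_norm_le (c := w) (f := p)
      (R := 1 / M) (C := Real.exp 2 * K) (by positivity) hpd.diffContOnCl ?_
    · calc _ ≤ _ := this
        _ = _ := by field_simp
    · intro z hz
      have hz1 : ‖z‖ ≤ 1 + 1 / M := by
        have h1 : ‖z - w‖ = 1 / M := by simpa [dist_eq_norm] using hz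
        calc ‖z‖ = ‖w + (z - w)‖ := by ring_nf
          _ ≤ _ := (norm_add_le _ _).trans (by rw [hw, h1])
      refine (pout z _ (by simp) hz1).trans ?_
      gcongr
      calc (1 + 1 / (M : ℝ)) ^ (2 * M) ≤ (Real.exp (1 / M)) ^ (2 * M) := by
            gcongr
            linarith [Real.add_one_le_exp (1 / (M : ℝ))]
        _ = Real.exp 2 := by
            rw [← Real.exp_nat_mul]; congr 1; push_cast; field_simp
  -- Differentiating f = w^(-M) p(w): the factor w^(-M) contributes MΩK, and p contributes e² MΩK.
  have hfp : f = fun s : ℝ => Complex.exp (-(M * (Complex.I * Ω)) * s) *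
      p (Complex.exp (Complex.I * Ω * s)) := by
    ext s
    rw [pf, ← Complex.exp_nat_mul, ← mul_assoc, ← Complex.exp_add]
    rw [show -(M * (Complex.I * Ω)) * s + (M : ℂ) * (Complex.I * Ω * s) = 0 by ring]
    simp
  have hder : HasDerivAt f (-(M * (Complex.I * Ω)) * f t +
      Complex.exp (-(M * (Complex.I * Ω)) * t) *
        (Complex.I * Ω * Complex.exp (Complex.I * Ω * t) *
          deriv p (Complex.exp (Complex.I * Ω * t)))) t := by
    have hpt := (hpd (Complex.exp (Complex.I * Ω * t))).hasDerivAt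
    have := (hasDerivAt_cexp_mul (-(M * (Complex.I * Ω))) t).mul
      (hpt.comp t (hasDerivAt_cexp_mul (Complex.I * Ω) t))
    have e := congrFun hfp t
    refine (this.congr_of_eventuallyEq (Filter.EventuallyEq.of_eq hfp)).congr_deriv ?_
    rw [e]; simp only [Function.comp]; ring
  rw [hder.deriv]
  have n1 : ‖Complex.exp (-(M * (Complex.I * Ω)) * t)‖ = 1 := by
    rw [Complex.norm_exp]; simp
  refine (norm_add_le _ _).trans ?_
  simp only [norm_mul, norm_neg, n1, nexp, Complex.norm_natCast, Complex.norm_I,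
    Complex.norm_real, Real.norm_eq_abs, abs_of_pos hΩ, one_mul, mul_one]
  have a1 := hK t
  have a2 := dp _ (nexp t)
  calc (M * Ω) * ‖f t‖ + Ω * ‖deriv p (Complex.exp (Complex.I * Ω * t))‖
      ≤ (M * Ω) * K + Ω * (M * (Real.exp 2 * K)) := by gcongr
    _ = _ := by ring

/-! ### One-dimensional estimates -/

lemma norm_deriv_sub_deriv_le {f : ℝ → ℂ} (hf : ContDiff ℝ 2 f) {a b x y : ℝ}
    (hx : x ∈ Set.Icc a b) (hy : y ∈ Set.Icc a b) :
    ‖deriv f y - deriv f x‖ ≤ ∫ z in a..b, ‖deriv (deriv f) z‖ := by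
  have h1 : ContDiff ℝ 1 (deriv f) := by
    have : ContDiff ℝ (1 + 1) f := by simpa [one_add_one_eq_two] using hf
    exact (contDiff_succ_iff_deriv.1 this).2.2
  have hc : Continuous (deriv (deriv f)) := h1.continuous_deriv le_rfl
  have hd : Differentiable ℝ (deriv f) := h1.differentiable one_ne_zero
  wlog hxy : x ≤ y generalizing x y
  · rw [norm_sub_rev]; exact this hy hx (le_of_not_ge hxy)
  rw [← intervalIntegral.integral_deriv_eq_sub (fun z _ => hd z) (hc.intervalIntegrable _ _)]
  refine (intervalIntegral.norm_integral_le_integral_norm hxy).trans ?_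
  exact intervalIntegral.integral_mono_interval hx.1 hxy hy.2
    (Filter.Eventually.of_forall fun _ => norm_nonneg _) (hc.norm.intervalIntegrable _ _)

lemma norm_sub_linear_le {f : ℝ → ℂ} (hf : ContDiff ℝ 2 f) {a b x y z : ℝ}
    (hx : x ∈ Set.Icc a b) (hy : y ∈ Set.Icc a b) (hz : z ∈ Set.Icc a b) :
    ‖f y - f x - (y - x) * deriv f z‖ ≤ |y - x| * ∫ z in a..b, ‖deriv (deriv f) z‖ := by
  have hd : Differentiable ℝ f := hf.differentiable two_ne_zero
  have hc : Continuous (deriv f) := hf.continuous_deriv (by norm_num)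
  have e : f y - f x - (y - x) * deriv f z = ∫ w in x..y, (deriv f w - deriv f z) := by
    rw [intervalIntegral.integral_sub (hc.intervalIntegrable _ _) (by simp),
      intervalIntegral.integral_deriv_eq_sub (fun z _ => hd z) (hc.intervalIntegrable _ _)]
    simp
  rw [e, mul_comm]
  refine intervalIntegral.norm_integral_le_of_norm_le_const fun w hw => ?_
  refine norm_deriv_sub_deriv_le hf hz ?_
  exact Set.OrdConnected.uIcc_subset Set.ordConnected_Icc hx hy (Set.uIoc_subset_uIcc hw)

/-- A minimiser of |f| on [c, d] does not exceed the average of |f|. -/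
lemma exists_norm_le_average {f : ℝ → ℂ} (hf : Continuous f) {a b c d : ℝ} (hac : a ≤ c)
    (hcd : c < d) (hdb : d ≤ b) :
    ∃ x ∈ Set.Icc c d, (d - c) * ‖f x‖ ≤ ∫ z in a..b, ‖f z‖ := by
  obtain ⟨x, hx, hmin⟩ := isCompact_Icc.exists_isMinOn (Set.nonempty_Icc.2 hcd.le)
    hf.norm.continuousOn
  refine ⟨x, hx, ?_⟩
  calc (d - c) * ‖f x‖ = ∫ _ in c..d, ‖f x‖ := by simp
    _ ≤ ∫ z in c..d, ‖f z‖ := by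
      refine intervalIntegral.integral_mono_on hcd.le (by simp)
        (hf.norm.intervalIntegrable _ _) fun z hz => hmin hz
    _ ≤ _ := intervalIntegral.integral_mono_interval hac hcd.le hdb
      (Filter.Eventually.of_forall fun _ => norm_nonneg _) (hf.norm.intervalIntegrable _ _)

/-- Interpolation of the first derivative between `f` and its second derivative, in `L¹`. -/
lemma norm_deriv_le_interpolation {f : ℝ → ℂ} (hf : ContDiff ℝ 2 f) {a b z : ℝ} (hab : a < b)
    (hz : z ∈ Set.Icc a b) :
    ‖deriv f z‖ ≤ 18 / (b - a) ^ 2 * (∫ x in a..b, ‖f x‖) + ∫ x in a..b, ‖deriv (deriv f) x‖ := by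
  set g := b - a with hg
  have hg0 : 0 < g := by rw [hg]; linarith
  set F := ∫ x in a..b, ‖f x‖
  set E := ∫ x in a..b, ‖deriv (deriv f) x‖
  -- The points x and y are taken in the outer thirds of [a, b], where |f| is at most 3F/g. As y - x
  -- ≥ g/3, the slope between them is at most 18F/g², and f'(z) differs from this slope by at most
  -- E.
  obtain ⟨x, hx, hxF⟩ := exists_norm_le_average (f := f) hf.continuous (a := a) (b := b)
    (c := a) (d := a + g / 3) le_rfl (by linarith) (by linarith)
  obtain ⟨y, hy, hyF⟩ := exists_norm_le_average (f := f) hf.continuous (a := a) (b := b)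
    (c := b - g / 3) (d := b) (by linarith) (by linarith) le_rfl
  have hl := norm_sub_linear_le hf (x := x) (y := y) (z := z) (a := a) (b := b)
    ⟨hx.1, by linarith [hx.2]⟩ ⟨by linarith [hy.1], hy.2⟩ hz
  have hyx : g / 3 ≤ y - x := by linarith [hx.2, hy.1]
  have hyx0 : 0 < y - x := by linarith
  have h1 : (y - x) * ‖deriv f z‖ ≤ ‖f y‖ + ‖f x‖ + (y - x) * E := by
    have e : ((y - x : ℝ) : ℂ) * deriv f z = f y - f x - (f y - f x - (y - x) * deriv f z) := by
      push_cast; ring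
    have := congrArg norm e
    rw [norm_mul, Complex.norm_real, Real.norm_eq_abs, abs_of_pos hyx0] at this
    rw [this]
    rw [abs_of_pos hyx0] at hl
    exact (norm_sub_le _ _).trans (add_le_add (norm_sub_le _ _) hl)
  have hx3 : ‖f x‖ ≤ 3 / g * F := by
    rw [div_mul_eq_mul_div, le_div_iff₀ hg0]; linarith
  have hy3 : ‖f y‖ ≤ 3 / g * F := by
    rw [div_mul_eq_mul_div, le_div_iff₀ hg0]; linarith
  have hF0 : 0 ≤ F := by
    refine le_trans ?_ hxF
    have : 0 ≤ a + g / 3 - a := by linarith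
    positivity
  have h2 : (y - x) * (‖deriv f z‖ - E) ≤ 6 / g * F := by
    have : 6 / g * F = 3 / g * F + 3 / g * F := by ring
    linarith
  rcases le_or_gt (‖deriv f z‖ - E) 0 with h3 | h3
  · have : 0 ≤ 18 / g ^ 2 * F := by positivity
    linarith
  · have h4 : g / 3 * (‖deriv f z‖ - E) ≤ 6 / g * F :=
      (mul_le_mul_of_nonneg_right hyx h3.le).trans h2
    have h5 : ‖deriv f z‖ - E ≤ 18 / g ^ 2 * F := by
      have := mul_le_mul_of_nonneg_left h4 (show 0 ≤ 3 / g by positivity)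
      calc _ = 3 / g * (g / 3 * (‖deriv f z‖ - E)) := by field_simp
        _ ≤ _ := this
        _ = _ := by field_simp; ring
    linarith

lemma norm_sub_average_le {f : ℝ → ℂ} (hf : ContDiff ℝ 1 f) {a b x K : ℝ} (hab : a < b)
    (hx : x ∈ Set.Icc a b) (hK : ∀ z ∈ Set.Icc a b, ‖deriv f z‖ ≤ K) :
    ‖f x - ((b - a)⁻¹ : ℝ) * ∫ z in a..b, f z‖ ≤ (b - a) * K := by
  have hd : Differentiable ℝ f := hf.differentiable one_ne_zero
  have hb : b - a ≠ 0 := by linarith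
  have hb' : ((b : ℂ) - a) ≠ 0 := by exact_mod_cast hb
  have hK0 : 0 ≤ K := (norm_nonneg _).trans (hK x hx)
  have e : f x - ((b - a)⁻¹ : ℝ) * ∫ z in a..b, f z =
      ((b - a)⁻¹ : ℝ) * ∫ z in a..b, (f x - f z) := by
    rw [intervalIntegral.integral_sub (by simp) (hf.continuous.intervalIntegrable _ _)]
    simp only [intervalIntegral.integral_const, Complex.real_smul]
    push_cast; field_simp
  rw [e, norm_mul, Complex.norm_real, Real.norm_eq_abs, abs_of_pos (by simpa using hab)]
  have : ‖∫ z in a..b, (f x - f z)‖ ≤ ((b - a) * K) * |b - a| := by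
    refine intervalIntegral.norm_integral_le_of_norm_le_const fun w hw => ?_
    rw [Set.uIoc_of_le hab.le] at hw
    have hw' : w ∈ Set.Icc a b := ⟨hw.1.le, hw.2⟩
    have := (convex_Icc a b).norm_image_sub_le_of_norm_deriv_le (fun z _ => hd z) hK hw' hx
    refine this.trans ?_
    rw [mul_comm]
    gcongr
    rw [Real.norm_eq_abs, abs_le]
    constructor <;> linarith [hx.1, hx.2, hw.1, hw.2]
  rw [abs_of_pos (by linarith)] at this
  calc _ ≤ (b - a)⁻¹ * (((b - a) * K) * (b - a)) := by
        gcongr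
    _ = _ := by field_simp

/-! ### Square-integrable majorants -/

/-- Cauchy-Schwarz inequality for the lower integral. -/
lemma lintegral_mul_le_sqrt {α : Type*} [MeasurableSpace α] (μ : MeasureTheory.Measure α)
    {f g : α → ENNReal} (hf : AEMeasurable f μ) (hg : AEMeasurable g μ) :
    ∫⁻ x, f x * g x ∂μ ≤
      (∫⁻ x, f x ^ 2 ∂μ) ^ (1 / 2 : ℝ) * (∫⁻ x, g x ^ 2 ∂μ) ^ (1 / 2 : ℝ) := by
  have := ENNReal.lintegral_mul_le_Lp_mul_Lq μ Real.HolderConjugate.two_two hf hg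
  simpa using this

/-- Minkowski's inequality for series of nonnegative functions in `L²`. -/
lemma lintegral_sq_tsum_le {α : Type*} [MeasurableSpace α] (μ : MeasureTheory.Measure α)
    {f : ℤ → α → ENNReal} (hf : ∀ n, AEMeasurable (f n) μ) :
    ∫⁻ x, (∑' n, f n x) ^ 2 ∂μ ≤ (∑' n, (∫⁻ x, f n x ^ 2 ∂μ) ^ (1 / 2 : ℝ)) ^ 2 := by
  -- The square is expanded into a double series and Cauchy-Schwarz is applied to each product. The
  -- resulting double series is the square of the sum of the norms.
  have e : ∀ x, (∑' n, f n x) ^ 2 = ∑' n, ∑' m, f n x * f m x := by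
    intro x
    rw [sq, ← ENNReal.tsum_mul_right]
    simp_rw [ENNReal.tsum_mul_left]
  simp_rw [e]
  have hm : ∀ n m, AEMeasurable (fun x => f n x * f m x) μ := fun n m => (hf n).mul (hf m)
  have hs : ∀ n, AEMeasurable (fun x => ∑' m, f n x * f m x) μ :=
    fun n => AEMeasurable.tsum (hm n)
  rw [MeasureTheory.lintegral_tsum hs]
  rw [sq, ← ENNReal.tsum_mul_right]
  refine ENNReal.tsum_le_tsum fun n => ?_
  rw [MeasureTheory.lintegral_tsum (hm n), ← ENNReal.tsum_mul_left]
  exact ENNReal.tsum_le_tsum fun m => lintegral_mul_le_sqrt μ (hf n) (hf m)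

lemma sq_lintegral_Ioc_le {h : ℝ → ENNReal} (hh : AEMeasurable h) {a b L : ℝ} (hL : b - a ≤ L) :
    (∫⁻ x in Set.Ioc a b, h x) ^ 2 ≤ ENNReal.ofReal L * ∫⁻ x in Set.Ioc a b, h x ^ 2 := by
  have := lintegral_mul_le_sqrt (MeasureTheory.volume.restrict (Set.Ioc a b)) (f := fun _ => 1)
    (g := h) aemeasurable_const hh.restrict
  simp only [one_mul, one_pow, MeasureTheory.lintegral_one, MeasureTheory.Measure.restrict_apply,
    MeasurableSet.univ, Set.univ_inter, Real.volume_Ioc] at this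
  calc _ ≤ ((ENNReal.ofReal (b - a)) ^ (1 / 2 : ℝ) *
        (∫⁻ x in Set.Ioc a b, h x ^ 2) ^ (1 / 2 : ℝ)) ^ 2 := by gcongr
    _ = ENNReal.ofReal (b - a) * ∫⁻ x in Set.Ioc a b, h x ^ 2 := by
      rw [← ENNReal.mul_rpow_of_nonneg _ _ (by norm_num), ← ENNReal.rpow_natCast,
        ← ENNReal.rpow_mul]
      norm_num
    _ ≤ _ := by gcongr

/-- The `L¹` norms of an `L²` function on consecutive bounded intervals are square summable. -/
lemma tsum_sq_lintegral_Ioc_le {xs : ℤ → ℝ} (hx : Monotone xs) {L : ℝ}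
    (hL : ∀ q, xs (q + 1) - xs q ≤ L) {h : ℝ → ENNReal} (hh : AEMeasurable h) :
    ∑' q, (∫⁻ x in Set.Ioc (xs q) (xs (q + 1)), h x) ^ 2 ≤
      ENNReal.ofReal L * ∫⁻ x, h x ^ 2 := by
  calc _ ≤ ∑' q, ENNReal.ofReal L * ∫⁻ x in Set.Ioc (xs q) (xs (q + 1)), h x ^ 2 :=
        ENNReal.tsum_le_tsum fun q => sq_lintegral_Ioc_le hh (hL q)
    _ = ENNReal.ofReal L * ∫⁻ x in ⋃ q, Set.Ioc (xs q) (xs (q + 1)), h x ^ 2 := by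
      rw [ENNReal.tsum_mul_left, MeasureTheory.lintegral_iUnion (fun _ => measurableSet_Ioc)]
      exact hx.pairwise_disjoint_on_Ioc_succ
    _ ≤ _ := by
      gcongr
      exact MeasureTheory.Measure.restrict_le_self

/-! ### Differentiation in the second variable -/

/-- The partial derivative with respect to the second variable. -/
def partialTime (U : ℝ × ℝ → ℂ) (z : ℝ × ℝ) : ℂ := fderiv ℝ U z (0, 1)

lemma contDiff_partialTime {U : ℝ × ℝ → ℂ} {n : ℕ} (hU : ContDiff ℝ (n + 1) U) :
    ContDiff ℝ n (partialTime U) :=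
  (hU.fderiv_right le_rfl).clm_apply contDiff_const

lemma hasDerivAt_partialTime {U : ℝ × ℝ → ℂ} (hU : Differentiable ℝ U) (x t : ℝ) :
    HasDerivAt (fun τ => U (x, τ)) (partialTime U (x, t)) t := by
  have h1 : HasDerivAt (fun τ : ℝ => (x, τ)) ((0 : ℝ), (1 : ℝ)) t :=
    (hasDerivAt_const t x).prodMk (hasDerivAt_id t)
  exact (hU (x, t)).hasFDerivAt.comp_hasDerivAt t h1

lemma hasDerivAt_integral_partialTime {U : ℝ × ℝ → ℂ} (hU : ContDiff ℝ 1 U) (a b t : ℝ) :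
    HasDerivAt (fun τ => ∫ x in a..b, U (x, τ)) (∫ x in a..b, partialTime U (x, t)) t := by
  have hc := hU.continuous
  have hc' : Continuous (partialTime U) :=
    (contDiff_partialTime (n := 0) (by simpa using hU)).continuous
  obtain ⟨K, hK⟩ := (isCompact_uIcc (a := a) (b := b)).prod (isCompact_Icc (a := t - 1)
    (b := t + 1)) |>.exists_bound_of_continuousOn hc'.continuousOn
  refine (intervalIntegral.hasDerivAt_integral_of_dominated_loc_of_deriv_le
    (F := fun τ x => U (x, τ)) (F' := fun τ x => partialTime U (x, τ)) (bound := fun _ => K)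
    (Icc_mem_nhds (show t - 1 < t by linarith) (show t < t + 1 by linarith)) ?_ ?_ ?_ ?_ ?_ ?_).2
  · exact Filter.Eventually.of_forall fun τ => Continuous.aestronglyMeasurable (by fun_prop)
  · exact Continuous.intervalIntegrable (by fun_prop) _ _
  · exact Continuous.aestronglyMeasurable (by fun_prop)
  · exact Filter.Eventually.of_forall fun x hx τ hτ =>
      hK (x, τ) ⟨Set.uIoc_subset_uIcc hx, hτ⟩
  · simp
  · exact Filter.Eventually.of_forall fun x _ τ _ =>
      hasDerivAt_partialTime (hU.differentiable one_ne_zero) x τ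

/-! ### Geometry of the resonator array -/

lemma resIndex_div {N : ℕ} (m : ℤ) (i : Fin N) : resIndex m i / (N : ℤ) = m := by
  have hi : (i : ℤ) < N := by exact_mod_cast i.2
  rw [resIndex, add_comm, Int.add_mul_ediv_right _ _ (by omega),
    Int.ediv_eq_zero_of_lt (by omega) hi, zero_add]

lemma resIndex_mod {N : ℕ} (m : ℤ) (i : Fin N) : resIndex m i % (N : ℤ) = i := by
  have hi : (i : ℤ) < N := by exact_mod_cast i.2
  rw [resIndex, add_comm, Int.add_mul_emod_self_right, Int.emod_eq_of_lt (by omega) hi]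

/-- The enumeration of the resonators by cell and position in the cell. -/
def resEquiv (N : ℕ) (hN : 0 < N) : ℤ × Fin N ≃ ℤ where
  toFun q := resIndex q.1 q.2
  invFun p := (p / N, ⟨(p % N).toNat, by
    have h1 := Int.emod_lt_of_pos p (show (0 : ℤ) < N by omega)
    have h2 := Int.emod_nonneg p (show (N : ℤ) ≠ 0 by omega)
    omega⟩)
  left_inv q := by
    ext
    · exact resIndex_div q.1 q.2
    · simp [resIndex_mod]
  right_inv p := by
    have h2 := Int.emod_nonneg p (show (N : ℤ) ≠ 0 by omega)
    simp only [resIndex]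
    rw [Int.toNat_of_nonneg h2, mul_comm]
    exact Int.mul_ediv_add_emod p N

lemma exists_resIndex {N : ℕ} (hN : 0 < N) (p : ℤ) : ∃ (m : ℤ) (i : Fin N), p = resIndex m i :=
  ⟨_, _, ((resEquiv N hN).apply_symm_apply p).symm⟩

lemma resIndex_add_mul {N : ℕ} (m n : ℤ) (i : Fin N) :
    resIndex m i + n * (N : ℤ) = resIndex (m + n) i := by
  simp only [resIndex]; ring

lemma add_mul_of_add {N : ℕ} {f : ℤ → ℝ} {L : ℝ} (hf : ∀ p, f (p + N) = f p + L) (p m : ℤ) :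
    f (p + m * N) = f p + m * L := by
  induction m using Int.induction_on with
  | zero => simp
  | succ k ih =>
    rw [show p + ((k : ℤ) + 1) * N = p + k * N + N by ring, hf, ih]; push_cast; ring
  | pred k ih =>
    have := hf (p + (-(k : ℤ) - 1) * N)
    rw [show p + (-(k : ℤ) - 1) * N + N = p + -(k : ℤ) * N by ring, ih] at this
    push_cast at *; linarith

namespace ResonatorArray

variable {N : ℕ} (G : ResonatorArray N)

/-- Length of the gap to the right of the `p`-th resonator. -/
def gapLen (p : ℤ) : ℝ := G.xm (p + 1) - G.xp p

lemma gapLen_pos (p : ℤ) : 0 < G.gapLen p := sub_pos.2 (G.lt_gap p)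

lemma xp_strictMono : StrictMono G.xp :=
  strictMono_int_of_lt_succ fun p => (G.lt_gap p).trans (G.lt_resonator (p + 1))

lemma xm_strictMono : StrictMono G.xm :=
  strictMono_int_of_lt_succ fun p => (G.lt_resonator p).trans (G.lt_gap p)

lemma xm_add_mul (p m : ℤ) : G.xm (p + m * N) = G.xm p + m * G.L :=
  add_mul_of_add G.xm_periodic p m

lemma xp_add_mul (p m : ℤ) : G.xp (p + m * N) = G.xp p + m * G.L :=
  add_mul_of_add G.xp_periodic p m

lemma gapLen_add_mul (p m : ℤ) : G.gapLen (p + m * N) = G.gapLen p := by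
  simp only [gapLen]
  rw [show p + m * (N : ℤ) + 1 = p + 1 + m * N by ring, G.xm_add_mul, G.xp_add_mul]; ring

lemma left_eq (m : ℤ) (i : Fin N) : G.left m i = G.left 0 i + m * G.L := by
  rw [left, left, ← G.xm_add_mul, resIndex_add_mul, zero_add]

lemma right_eq (m : ℤ) (i : Fin N) : G.right m i = G.right 0 i + m * G.L := by
  rw [right, right, ← G.xp_add_mul, resIndex_add_mul, zero_add]

lemma len_eq (m : ℤ) (i : Fin N) : G.right m i - G.left m i = G.len i := by
  rw [G.left_eq, G.right_eq, len]; ring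

lemma len_pos (i : Fin N) : 0 < G.len i := sub_pos.2 (G.lt_resonator _)

lemma xp_succ_sub_le (p : ℤ) : G.xp (p + 1) - G.xp p ≤ G.L := by
  have h1 := G.xp_strictMono.monotone (show p + 1 ≤ p + N by have := G.N_pos; omega)
  rw [G.xp_periodic] at h1; linarith

lemma len_le (i : Fin N) : G.len i ≤ G.L := by
  have h1 := G.xp_succ_sub_le (resIndex 0 i - 1)
  have h2 := G.lt_gap (resIndex 0 i - 1)
  rw [sub_add_cancel] at h1 h2
  simp only [len, left, right]; linarith

/-- By periodicity only N gap lengths occur. The bound depends on the geometry alone, as the final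
constant must. -/
lemma exists_gapLen_lower : ∃ g : ℝ, 0 < g ∧ ∀ p, g ≤ G.gapLen p := by
  have : Nonempty (Fin N) := ⟨⟨0, G.N_pos⟩⟩
  obtain ⟨i, hi⟩ := Finite.exists_min fun i : Fin N => G.gapLen (resIndex 0 i)
  refine ⟨_, G.gapLen_pos (resIndex 0 i), fun p => ?_⟩
  obtain ⟨m, j, rfl⟩ := exists_resIndex G.N_pos p
  refine (hi j).trans_eq ?_
  rw [← G.gapLen_add_mul _ m, resIndex_add_mul, zero_add]

lemma exists_len_lower : ∃ l : ℝ, 0 < l ∧ ∀ i, l ≤ G.len i := by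
  have : Nonempty (Fin N) := ⟨⟨0, G.N_pos⟩⟩
  obtain ⟨i, hi⟩ := Finite.exists_min G.len
  exact ⟨_, G.len_pos i, hi⟩

/-! ### The quasiperiodic potentials -/

/-- The constant value of `V_j^α` on the `p`-th resonator. -/
def bloch (α : ℝ) (j : Fin N) (p : ℤ) : ℂ :=
  if p % (N : ℤ) = j then Complex.exp (Complex.I * α * (p / (N : ℤ) : ℤ) * G.L) else 0

lemma bloch_resIndex (α : ℝ) (j : Fin N) (m : ℤ) (i : Fin N) :
    G.bloch α j (resIndex m i) =
      Complex.exp (Complex.I * α * m * G.L) * if i = j then 1 else 0 := by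
  simp [bloch, resIndex_mod, resIndex_div, Fin.ext_iff]

lemma bloch_add_mul (α : ℝ) (j : Fin N) (p m : ℤ) :
    G.bloch α j (p + m * N) = Complex.exp (Complex.I * α * m * G.L) * G.bloch α j p := by
  obtain ⟨n, i, rfl⟩ := exists_resIndex G.N_pos p
  rw [resIndex_add_mul, bloch_resIndex, bloch_resIndex, ← mul_assoc, ← Complex.exp_add]
  congr 2; push_cast; ring

/-- The piecewise linear function that increases from `0` to `1` on the gap after the `p`-th
resonator. -/
def ramp (p : ℤ) (x : ℝ) : ℝ := max 0 (min 1 ((x - G.xp p) / G.gapLen p))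

lemma ramp_of_le {p : ℤ} {x : ℝ} (h : x ≤ G.xp p) : G.ramp p x = 0 := by
  have : (x - G.xp p) / G.gapLen p ≤ 0 :=
    div_nonpos_of_nonpos_of_nonneg (by linarith) (G.gapLen_pos p).le
  exact max_eq_left ((min_le_right _ _).trans this)

lemma ramp_of_ge {p : ℤ} {x : ℝ} (h : G.xm (p + 1) ≤ x) : G.ramp p x = 1 := by
  have : 1 ≤ (x - G.xp p) / G.gapLen p := by
    rw [le_div_iff₀ (G.gapLen_pos p), gapLen]; linarith
  rw [ramp, min_eq_left this]; norm_num

lemma ramp_of_mem {p : ℤ} {x : ℝ} (h : x ∈ Set.Icc (G.xp p) (G.xm (p + 1))) :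
    G.ramp p x = (x - G.xp p) / G.gapLen p := by
  have h1 : (x - G.xp p) / G.gapLen p ≤ 1 := by
    rw [div_le_one (G.gapLen_pos p), gapLen]; linarith [h.2]
  have h0 : 0 ≤ (x - G.xp p) / G.gapLen p :=
    div_nonneg (by linarith [h.1]) (G.gapLen_pos p).le
  rw [ramp, min_eq_right h1, max_eq_right h0]

lemma continuous_ramp (p : ℤ) : Continuous (G.ramp p) := by
  unfold ramp; fun_prop

lemma ramp_shift (p m : ℤ) (x : ℝ) : G.ramp (p + m * N) (x + m * G.L) = G.ramp p x := by
  rw [ramp, ramp, G.gapLen_add_mul, G.xp_add_mul]; congr 3; ring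

/-- The trapezoidal function equal to `1` on the `p`-th resonator and to `0` on the others. -/
def hat (p : ℤ) (x : ℝ) : ℝ := G.ramp (p - 1) x - G.ramp p x

lemma hat_eq_zero_left {p : ℤ} {x : ℝ} (h : x ≤ G.xp (p - 1)) : G.hat p x = 0 := by
  rw [hat, G.ramp_of_le h, G.ramp_of_le (h.trans (G.xp_strictMono.monotone (by omega))), sub_zero]

lemma hat_eq_zero_right {p : ℤ} {x : ℝ} (h : G.xm (p + 1) ≤ x) : G.hat p x = 0 := by
  rw [hat, G.ramp_of_ge h, G.ramp_of_ge (le_trans (G.xm_strictMono.monotone (by omega)) h),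
    sub_self]

/-- The piecewise linear function with value `c p` on the `p`-th resonator. -/
def interpolant (c : ℤ → ℂ) (x : ℝ) : ℂ := ∑ᶠ p, c p * (G.hat p x : ℂ)

lemma continuous_interpolant (c : ℤ → ℂ) : Continuous (G.interpolant c) := by
  unfold interpolant
  refine continuous_finsum (fun p => ?_) fun x => ?_
  · have h1 := G.continuous_ramp p
    have h2 := G.continuous_ramp (p - 1)
    unfold hat
    fun_prop
  · refine ⟨Set.Ioo (x - 1) (x + 1), Ioo_mem_nhds (by linarith) (by linarith), ?_⟩
    -- The cells between -n and m cover (x - 1, x + 1), and a hat is supported between the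
    -- neighbouring resonators, so only finitely many hats are nonzero there.
    obtain ⟨m, hm⟩ := exists_nat_gt ((x + 1) / G.L)
    obtain ⟨n, hn⟩ := exists_nat_gt ((G.xm 0 - (x - 1)) / G.L)
    rw [div_lt_iff₀ G.L_pos] at hm hn
    refine (Set.finite_Icc (-(n : ℤ) * N) ((m : ℤ) * N + 1)).subset ?_
    rintro p ⟨y, hy, hy1, hy2⟩
    have hne : G.hat p y ≠ 0 := by
      intro h0
      exact hy (by simp [h0])
    have ha : G.xp (p - 1) < y := lt_of_not_ge fun h => hne (G.hat_eq_zero_left h)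
    have hb : y < G.xm (p + 1) := lt_of_not_ge fun h => hne (G.hat_eq_zero_right h)
    have h1 := G.xp_add_mul 0 m
    have h2 := G.xm_add_mul 0 (-n)
    have h0 := G.first_in_cell
    have h0' := G.lt_resonator 0
    push_cast at h1 h2
    have hc : p - 1 < 0 + (m : ℤ) * N := G.xp_strictMono.lt_iff_lt.1 (by linarith)
    have hd : 0 + -(n : ℤ) * N < p + 1 := G.xm_strictMono.lt_iff_lt.1 (by linarith)
    constructor <;> omega

lemma interpolant_eq (c : ℤ → ℂ) {p : ℤ} {x : ℝ} (hx : x ∈ Set.Icc (G.xp p) (G.xp (p + 1))) :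
    G.interpolant c x = c p * (1 - G.ramp p x : ℝ) + c (p + 1) * (G.ramp p x : ℝ) := by
  have hs : (Function.support fun q => c q * (G.hat q x : ℂ)) ⊆
      (({p, p + 1} : Finset ℤ) : Set ℤ) := by
    intro q hq
    have hne : G.hat q x ≠ 0 := by
      intro h0
      exact hq (by simp [h0])
    have ha : G.xp (q - 1) < x := lt_of_not_ge fun h => hne (G.hat_eq_zero_left h)
    have hb : x < G.xm (q + 1) := lt_of_not_ge fun h => hne (G.hat_eq_zero_right h)
    have h1 : q - 1 < p + 1 := G.xp_strictMono.lt_iff_lt.1 (ha.trans_le hx.2)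
    have h2 : p < q + 1 :=
      G.xp_strictMono.lt_iff_lt.1 (hx.1.trans_lt (hb.trans (G.lt_resonator _)))
    simp only [Finset.coe_insert, Finset.coe_singleton, Set.mem_insert_iff,
      Set.mem_singleton_iff]
    omega
  rw [interpolant, finsum_eq_sum_of_support_subset _ hs, Finset.sum_pair (by omega)]
  have e1 : G.hat p x = 1 - G.ramp p x := by
    rw [hat, G.ramp_of_ge]
    rw [sub_add_cancel]; exact (G.lt_resonator p).le.trans hx.1
  have e2 : G.hat (p + 1) x = G.ramp p x := by
    rw [hat, add_sub_cancel_right, G.ramp_of_le hx.2, sub_zero]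
  rw [e1, e2]

lemma interpolant_gap (c : ℤ → ℂ) {p : ℤ} {x : ℝ} (hx : x ∈ Set.Ioo (G.xp p) (G.xm (p + 1))) :
    G.interpolant c x = c p + (c (p + 1) - c p) / G.gapLen p * (x - G.xp p) := by
  rw [G.interpolant_eq c ⟨hx.1.le, hx.2.le.trans (G.lt_resonator _).le⟩,
    G.ramp_of_mem ⟨hx.1.le, hx.2.le⟩]
  push_cast; ring

/-- Existence for the quasiperiodic problem; without it `potential`, a choice by
`Classical.epsilon`, would carry no information. -/
lemma isPotential_interpolant (α : ℝ) (j : Fin N) :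
    G.IsPotential α j (G.interpolant (G.bloch α j)) := by
  refine ⟨G.continuous_interpolant _, fun p => ?_, fun p x hx => ?_, fun i x hx => ?_,
    fun m x => ?_⟩
  · refine ContDiffOn.congr (f := fun x : ℝ => G.bloch α j p +
      (G.bloch α j (p + 1) - G.bloch α j p) / G.gapLen p * ((x : ℂ) - G.xp p)) ?_
      fun x hx => G.interpolant_gap _ hx
    have : ContDiff ℝ 2 (fun x : ℝ => (x : ℂ)) := Complex.ofRealCLM.contDiff
    exact ContDiff.contDiffOn (by fun_prop)
  · have he : G.interpolant (G.bloch α j) =ᶠ[𝓝 x] fun x : ℝ => G.bloch α j p +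
        (G.bloch α j (p + 1) - G.bloch α j p) / G.gapLen p * ((x : ℂ) - G.xp p) := by
      filter_upwards [Ioo_mem_nhds hx.1 hx.2] with y hy using G.interpolant_gap _ hy
    rw [(he.iteratedDeriv_eq 2)]
    have hd : deriv (fun x : ℝ => G.bloch α j p +
        (G.bloch α j (p + 1) - G.bloch α j p) / G.gapLen p * ((x : ℂ) - G.xp p)) =
        fun _ => (G.bloch α j (p + 1) - G.bloch α j p) / G.gapLen p := by
      ext y
      have h1 := (((Complex.ofRealCLM.hasDerivAt (x := y)).sub_const (G.xp p : ℂ)).const_mul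
        ((G.bloch α j (p + 1) - G.bloch α j p) / G.gapLen p)).const_add (G.bloch α j p)
      simpa using h1.deriv
    rw [iteratedDeriv_succ, iteratedDeriv_one, hd]
    simp
  · have h1 := G.lt_gap (resIndex 0 i - 1)
    rw [sub_add_cancel] at h1
    rw [G.interpolant_eq (p := resIndex 0 i - 1) _ ⟨h1.le.trans hx.1.le, ?_⟩, G.ramp_of_ge,
      sub_add_cancel, bloch_resIndex]
    · simp
    · rw [sub_add_cancel]; exact hx.1.le
    · rw [sub_add_cancel]; exact hx.2.le
  · unfold interpolant
    rw [← smul_eq_mul (a := Complex.exp _), smul_finsum,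
      ← finsum_comp_equiv (Equiv.addRight (m * (N : ℤ)))]
    refine finsum_congr fun p => ?_
    simp only [Equiv.coe_addRight, bloch_add_mul, hat, smul_eq_mul]
    rw [show p + m * (N : ℤ) - 1 = p - 1 + m * N by ring, ramp_shift, ramp_shift, mul_assoc]

lemma isPotential_potential (α : ℝ) (j : Fin N) : G.IsPotential α j (G.potential α j) :=
  Classical.epsilon_spec ⟨_, G.isPotential_interpolant α j⟩

variable {G}

lemma IsPotential.eq_bloch {α : ℝ} {j : Fin N} {V : ℝ → ℂ} (hV : G.IsPotential α j V) (p : ℤ)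
    {x : ℝ} (hx : x ∈ Set.Icc (G.xm p) (G.xp p)) : V x = G.bloch α j p := by
  have key : Set.EqOn V (fun _ => G.bloch α j p) (Set.Ioo (G.xm p) (G.xp p)) := by
    intro y hy
    obtain ⟨m, i, rfl⟩ := exists_resIndex G.N_pos p
    change y ∈ Set.Ioo (G.left m i) (G.right m i) at hy
    rw [G.left_eq, G.right_eq] at hy
    have h1 := hV.quasiperiodic m (y - m * G.L)
    rw [sub_add_cancel,
      hV.on_resonator i (y - m * G.L) ⟨by linarith [hy.1], by linarith [hy.2]⟩] at h1
    rw [h1, bloch_resIndex]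
  have := key.closure hV.cont continuous_const
  rw [closure_Ioo (G.lt_resonator p).ne] at this
  exact this hx

/-- A function with zero second derivative is affine on the gap, and continuity fixes its end values
through `eq_bloch`. The argument applies to any solution, so it does not matter which one
`potential` selects. -/
lemma IsPotential.deriv_eq {α : ℝ} {j : Fin N} {V : ℝ → ℂ} (hV : G.IsPotential α j V) (p : ℤ)
    {x : ℝ} (hx : x ∈ Set.Ioo (G.xp p) (G.xm (p + 1))) :
    deriv V x = (G.bloch α j (p + 1) - G.bloch α j p) / G.gapLen p := by
  have hC := hV.smooth p
  have hdo : DifferentiableOn ℝ V (Set.Ioo (G.xp p) (G.xm (p + 1))) :=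
    hC.differentiableOn (by norm_num)
  have hdd : DifferentiableOn ℝ (deriv V) (Set.Ioo (G.xp p) (G.xm (p + 1))) := by
    have : ContDiffOn ℝ (1 + 1) V (Set.Ioo (G.xp p) (G.xm (p + 1))) := by
      simpa [one_add_one_eq_two] using hC
    exact ((contDiffOn_succ_iff_deriv_of_isOpen isOpen_Ioo).1 this).2.2.differentiableOn
      (by norm_num)
  obtain ⟨B, hB⟩ := isOpen_Ioo.exists_is_const_of_deriv_eq_zero isPreconnected_Ioo hdd
    (fun y hy => by
      have := hV.harmonic p y hy
      rw [iteratedDeriv_succ, iteratedDeriv_one] at this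
      simpa using this)
  have hlin : ∀ y : ℝ, HasDerivAt (fun y : ℝ => B * (y : ℂ)) B y := fun y => by
    simpa using (Complex.ofRealCLM.hasDerivAt (x := y)).const_mul B
  obtain ⟨A, hA⟩ := isOpen_Ioo.exists_is_const_of_deriv_eq_zero
    (f := fun y : ℝ => V y - B * y) isPreconnected_Ioo
    (hdo.sub fun y _ => (hlin y).differentiableAt.differentiableWithinAt) (fun y hy => by
      have h1 := ((hdo y hy).differentiableAt (isOpen_Ioo.mem_nhds hy)).hasDerivAt.sub (hlin y)
      rw [hB y hy, sub_self] at h1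
      exact h1.deriv)
  have hcl : Set.EqOn (fun y : ℝ => V y - B * y) (fun _ => A)
      (closure (Set.Ioo (G.xp p) (G.xm (p + 1)))) := by
    have := hV.cont
    exact Set.EqOn.closure (fun y hy => hA y hy) (by fun_prop) continuous_const
  rw [closure_Ioo (G.lt_gap p).ne] at hcl
  have e1 := hcl (Set.left_mem_Icc.2 (G.lt_gap p).le)
  have e2 := hcl (Set.right_mem_Icc.2 (G.lt_gap p).le)
  simp only at e1 e2
  rw [hV.eq_bloch p (Set.right_mem_Icc.2 (G.lt_resonator p).le)] at e1
  rw [hV.eq_bloch (p + 1) (Set.left_mem_Icc.2 (G.lt_resonator _).le)] at e2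
  have hg : (G.gapLen p : ℂ) ≠ 0 := by exact_mod_cast (G.gapLen_pos p).ne'
  rw [hB x hx, eq_div_iff hg]
  simp only [gapLen]
  push_cast
  linear_combination e1 - e2

end ResonatorArray

/-! ### One-sided traces. -/

lemma traceLeft_eq {w : ℝ → ℂ} {g : ℝ → ℂ} {a b : ℝ} (hab : a < b) (hg : ContinuousAt g b)
    (h : ∀ x ∈ Set.Ioo a b, w x = g x) : traceLeft w b = g b := by
  refine Filter.Tendsto.limUnder_eq ?_
  refine (hg.mono_left nhdsWithin_le_nhds).congr' ?_
  filter_upwards [Ioo_mem_nhdsLT hab] with x hx using (h x hx).symm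

lemma traceRight_eq {w : ℝ → ℂ} {g : ℝ → ℂ} {a b : ℝ} (hab : a < b) (hg : ContinuousAt g a)
    (h : ∀ x ∈ Set.Ioo a b, w x = g x) : traceRight w a = g a := by
  refine Filter.Tendsto.limUnder_eq ?_
  refine (hg.mono_left nhdsWithin_le_nhds).congr' ?_
  filter_upwards [Ioo_mem_nhdsGT hab] with x hx using (h x hx).symm

section CapacitanceMatrices

/-! ### The capacitance matrices -/

variable {N : ℕ} (G : ResonatorArray N)

lemma ResonatorArray.capMatrix_apply (α : ℝ) (i j : Fin N) :
    G.capMatrix α i j =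
      (G.bloch α j (resIndex 0 i) - G.bloch α j (resIndex 0 i - 1)) /
          G.gapLen (resIndex 0 i - 1) -
        (G.bloch α j (resIndex 0 i + 1) - G.bloch α j (resIndex 0 i)) /
          G.gapLen (resIndex 0 i) := by
  have hV := G.isPotential_potential α j
  simp only [capMatrix, Matrix.of_apply, boundaryFlux, left, right]
  rw [traceLeft_eq (a := G.xp (resIndex 0 i - 1)) (g := fun _ =>
      (G.bloch α j (resIndex 0 i) - G.bloch α j (resIndex 0 i - 1)) / G.gapLen (resIndex 0 i - 1))
      _ continuousAt_const,
    traceRight_eq (G.lt_gap (resIndex 0 i)) (g := fun _ =>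
      (G.bloch α j (resIndex 0 i + 1) - G.bloch α j (resIndex 0 i)) / G.gapLen (resIndex 0 i))
      continuousAt_const]
  · exact fun x hx => hV.deriv_eq _ hx
  · intro x hx
    have := hV.deriv_eq (resIndex 0 i - 1) (x := x)
    rw [sub_add_cancel] at this
    exact this hx
  · have := G.lt_gap (resIndex 0 i - 1)
    rwa [sub_add_cancel] at this

lemma integral_exp_int_mul {L : ℝ} (hL : 0 < L) (k : ℤ) :
    ∫ α in (-(Real.pi / L))..(Real.pi / L), Complex.exp (Complex.I * (k * L) * (α : ℂ)) =
      if k = 0 then ((2 * Real.pi / L : ℝ) : ℂ) else 0 := by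
  have hL' : (L : ℂ) ≠ 0 := by exact_mod_cast hL.ne'
  split_ifs with hk
  · simp only [hk, Int.cast_zero, zero_mul, mul_zero, Complex.exp_zero,
      intervalIntegral.integral_const, Complex.real_smul]
    push_cast; ring
  · have hk' : (k : ℂ) ≠ 0 := by exact_mod_cast hk
    rw [integral_exp_mul_complex (by simp [hk', hL'])]
    have : Complex.exp (Complex.I * (k * L) * ((Real.pi / L : ℝ) : ℂ)) =
        Complex.exp (Complex.I * (k * L) * ((-(Real.pi / L) : ℝ) : ℂ)) := by
      rw [Complex.exp_eq_exp_iff_exists_int]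
      refine ⟨k, ?_⟩
      push_cast; field_simp; ring
    rw [this, sub_self, zero_div]

lemma continuous_bloch (j : Fin N) (p : ℤ) : Continuous fun α => G.bloch α j p := by
  unfold ResonatorArray.bloch
  split_ifs <;> fun_prop

/-- In α, the value on a resonator of cell n is zero or the character e^(iαnL). Orthogonality of the
characters on the Brillouin zone leaves a Kronecker delta. -/
lemma invFloquet_bloch (j : Fin N) (p m : ℤ) :
    invFloquet G.L (fun α => G.bloch α j p) m = if p = resIndex m j then 1 else 0 := by
  obtain ⟨n, i, rfl⟩ := exists_resIndex G.N_pos p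
  have hL := G.L_pos
  have hL' : (G.L : ℂ) ≠ 0 := by exact_mod_cast hL.ne'
  have hpi : (Real.pi : ℂ) ≠ 0 := by exact_mod_cast Real.pi_ne_zero
  have hiff : resIndex n i = resIndex m j ↔ n = m ∧ i = j := by
    have := (resEquiv N G.N_pos).injective.eq_iff (a := (n, i)) (b := (m, j))
    simpa [resEquiv] using this
  have e : ∀ α : ℝ, G.bloch α j (resIndex n i) * Complex.exp (-(Complex.I * α * (m * G.L))) =
      (if i = j then 1 else 0) * Complex.exp (Complex.I * ((n - m : ℤ) * G.L) * α) := by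
    intro α
    rw [G.bloch_resIndex, mul_right_comm, ← Complex.exp_add, mul_comm]
    congr 2; push_cast; ring
  simp only [invFloquet, e]
  rw [intervalIntegral.integral_const_mul, integral_exp_int_mul hL]
  by_cases h1 : i = j <;> by_cases h2 : n = m
  · simp only [h1, h2, sub_self, if_true]
    push_cast; field_simp
  · rw [if_neg fun h => h2 (hiff.1 h).1]; simp [h2, sub_eq_zero]
  · rw [if_neg fun h => h1 (hiff.1 h).2]; simp [h1]
  · rw [if_neg fun h => h1 (hiff.1 h).2]; simp [h1]

/-- The entries of C^α are finite combinations of the values `bloch`, so the real-space matrix only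
couples a resonator to itself and its two neighbours on the chain. -/
lemma realCap_apply (P : Medium N) (m : ℤ) (i j : Fin N) :
    P.realCap G m i j = ((P.δ * P.κr i / P.ρr i / G.len i : ℝ) : ℂ) *
      (((if resIndex 0 i = resIndex m j then 1 else 0) -
          (if resIndex 0 i - 1 = resIndex m j then 1 else 0)) / G.gapLen (resIndex 0 i - 1) -
        ((if resIndex 0 i + 1 = resIndex m j then 1 else 0) -
          (if resIndex 0 i = resIndex m j then 1 else 0)) / G.gapLen (resIndex 0 i)) := by
  simp only [Medium.realCap, Medium.genCapMatrix, Matrix.of_apply, G.capMatrix_apply,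
    ← invFloquet_bloch G j]
  simp only [invFloquet]
  have hc := fun p => continuous_bloch G j p
  have hi : ∀ p, IntervalIntegrable (fun α : ℝ => G.bloch α j p *
      Complex.exp (-(Complex.I * α * (m * G.L)))) MeasureTheory.volume
      (-(Real.pi / G.L)) (Real.pi / G.L) := fun p =>
    Continuous.intervalIntegrable (by have := hc p; fun_prop) _ _
  set q := resIndex 0 i
  set k : ℂ := ((P.δ * P.κr i / P.ρr i / G.len i : ℝ) : ℂ)
  have e : ∀ α : ℝ, k * ((G.bloch α j q - G.bloch α j (q - 1)) / G.gapLen (q - 1) -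
      (G.bloch α j (q + 1) - G.bloch α j q) / G.gapLen q) *
        Complex.exp (-(Complex.I * α * (m * G.L))) =
      k * ((G.bloch α j q * Complex.exp (-(Complex.I * α * (m * G.L))) -
        G.bloch α j (q - 1) * Complex.exp (-(Complex.I * α * (m * G.L)))) / G.gapLen (q - 1) -
      (G.bloch α j (q + 1) * Complex.exp (-(Complex.I * α * (m * G.L))) -
        G.bloch α j q * Complex.exp (-(Complex.I * α * (m * G.L)))) / G.gapLen q) :=
    fun α => by ring
  simp only [e]
  rw [intervalIntegral.integral_const_mul, intervalIntegral.integral_sub,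
    intervalIntegral.integral_div, intervalIntegral.integral_div,
    intervalIntegral.integral_sub (hi _) (hi _), intervalIntegral.integral_sub (hi _) (hi _)]
  · ring
  · exact ((hi _).sub (hi _)).div_const _
  · exact ((hi _).sub (hi _)).div_const _

/-- The block Toeplitz operator is a weighted discrete Laplacian on the chain of resonators. -/
lemma hasSum_realCap (P : Medium N) (m : ℤ) (i : Fin N) (W : ℤ → ℂ) :
    HasSum (fun q : ℤ × Fin N => P.realCap G (q.1 - m) i q.2 * W (resIndex q.1 q.2))
      (((P.δ * P.κr i / P.ρr i / G.len i : ℝ) : ℂ) *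
        ((W (resIndex m i) - W (resIndex m i - 1)) / G.gapLen (resIndex m i - 1) -
          (W (resIndex m i + 1) - W (resIndex m i)) / G.gapLen (resIndex m i))) := by
  set p := resIndex m i with hp
  set k : ℂ := ((P.δ * P.κr i / P.ρr i / G.len i : ℝ) : ℂ) with hk
  -- Translation by m cells carries row m of the Toeplitz matrix to row 0, and the gap lengths are
  -- invariant under it.
  have h0 : resIndex 0 i = p + (-m) * N := by rw [hp, resIndex_add_mul, add_neg_cancel]
  have e : ∀ q : ℤ × Fin N, P.realCap G (q.1 - m) i q.2 * W (resIndex q.1 q.2) =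
      (fun r : ℤ => k * (((if r = p then 1 else 0) * W r - (if r = p - 1 then 1 else 0) * W r) /
          G.gapLen (p - 1) - ((if r = p + 1 then 1 else 0) * W r - (if r = p then 1 else 0) * W r) /
          G.gapLen p)) (resEquiv N G.N_pos q) := by
    intro q
    have hr : resIndex (q.1 - m) q.2 = resIndex q.1 q.2 + (-m) * N := by
      rw [resIndex_add_mul, sub_eq_add_neg]
    rw [realCap_apply, h0, hr]
    beta_reduce
    rw [show resEquiv N G.N_pos q = resIndex q.1 q.2 from rfl]
    rw [show p + -m * (N : ℤ) - 1 = p - 1 + -m * N by ring,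
      show p + -m * (N : ℤ) + 1 = p + 1 + -m * N by ring, G.gapLen_add_mul, G.gapLen_add_mul]
    simp only [add_left_inj, ← hk, eq_comm (b := resIndex q.1 q.2)]
    ring
  rw [funext e]
  refine ((resEquiv N G.N_pos).hasSum_iff (f := fun r : ℤ => k * (((if r = p then 1 else 0) * W r -
    (if r = p - 1 then 1 else 0) * W r) / G.gapLen (p - 1) -
    ((if r = p + 1 then 1 else 0) * W r - (if r = p then 1 else 0) * W r) / G.gapLen p))).2 ?_
  -- Each Kronecker series has at most one nonzero term, so no decay of W is required.
  have hs : ∀ s : ℤ, HasSum (fun r : ℤ => (if r = s then 1 else 0) * W r) (W s) := fun s => by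
    simpa using hasSum_single (f := fun r : ℤ => (if r = s then 1 else 0) * W r) s
      (fun r hr => by simp [hr])
  exact ((((hs p).sub (hs (p - 1))).div_const _).sub
    (((hs (p + 1)).sub (hs p)).div_const _)).mul_left k

end CapacitanceMatrices

/-! ### Subwavelength solutions and their majorant -/

/-- The hypotheses on the medium and on the localised subwavelength solution `u`. -/
structure SubwavelengthSolution {N : ℕ} (G : ResonatorArray N) (P : Medium N) (Λ γ : ℝ) (M : ℕ)
    (ω : ℂ) (u : ℝ → ℝ → ℂ) : Prop where
  Λ_pos : 0 < Λ
  γ_mem : γ ∈ Set.Ioo (0 : ℝ) 1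
  δ_lt : P.δ < 1
  regime : P.InRegime Λ γ M
  sol : IsWaveSolution G P u
  quasi : HasQuasifrequency ω P.Ω u
  loc : IsLocalised ω P.Ω u
  sub : IsSubwavelength Λ γ P.δ M ω P.Ω u

/-- The size of the leading-order relative error. -/
def Medium.smallness {N : ℕ} (P : Medium N) (γ : ℝ) : ℝ := P.δ ^ ((1 - γ) / 2)

/-- A common pointwise majorant of `u`, `∂ₜu` and `∂ₜ²u` up to weights. -/
def majorant (η : ℝ) (ω : ℂ) (Ω : ℝ) (u : ℝ → ℝ → ℂ) (x : ℝ) : ENNReal :=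
  ∑' n : ℤ, ENNReal.ofReal (η + ‖freq ω Ω n‖ ^ 2) * ‖mode ω Ω u n x‖ₑ

/-- The `L¹` norm of the majorant on the interval between consecutive right end points. -/
def cellMass {N : ℕ} (G : ResonatorArray N) (η : ℝ) (ω : ℂ) (Ω : ℝ) (u : ℝ → ℝ → ℂ) (q : ℤ) : ℝ :=
  (∫⁻ x in Set.Ioc (G.xp q) (G.xp (q + 1)), majorant η ω Ω u x).toReal

namespace SubwavelengthSolution

variable {N : ℕ} {G : ResonatorArray N} {P : Medium N} {Λ γ : ℝ} {M : ℕ} {ω : ℂ}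
  {u : ℝ → ℝ → ℂ}

lemma smallness_pos (_h : SubwavelengthSolution G P Λ γ M ω u) : 0 < P.smallness γ :=
  Real.rpow_pos_of_pos P.δ_pos _

lemma smallness_le_one (h : SubwavelengthSolution G P Λ γ M ω u) : P.smallness γ ≤ 1 :=
  Real.rpow_le_one P.δ_pos.le h.δ_lt.le (by linarith [h.γ_mem.2])

lemma δ_le_smallness (h : SubwavelengthSolution G P Λ γ M ω u) : P.δ ≤ P.smallness γ := by
  have := Real.rpow_le_rpow_of_exponent_ge P.δ_pos h.δ_lt.le
    (show (1 - γ) / 2 ≤ 1 by linarith [h.γ_mem.1])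
  rwa [Real.rpow_one] at this

lemma sqrt_δ_le (h : SubwavelengthSolution G P Λ γ M ω u) : √P.δ ≤ P.smallness γ := by
  rw [Real.sqrt_eq_rpow]
  exact Real.rpow_le_rpow_of_exponent_ge P.δ_pos h.δ_lt.le (by linarith [h.γ_mem.1])

/-- The origin of the exponent in the error: δ^(-γ/2) from the degree times δ^(1/2) from Ω is
δ^((1-γ)/2). -/
lemma degree_mul_le (h : SubwavelengthSolution G P Λ γ M ω u) :
    M * P.Ω ≤ Λ ^ 2 * P.smallness γ := by
  have hΛ := h.Λ_pos
  have h0 := P.δ_pos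
  calc M * P.Ω ≤ (Λ * P.δ ^ (-γ / 2)) * (Λ * √P.δ) := by
        have := P.Ω_pos
        exact mul_le_mul h.regime.M_upper h.regime.Ω_upper this.le (by positivity)
    _ = Λ ^ 2 * (P.δ ^ (-γ / 2) * P.δ ^ (1 / 2 : ℝ)) := by rw [Real.sqrt_eq_rpow]; ring
    _ = _ := by
      rw [← Real.rpow_add h0, Medium.smallness]; congr 2; ring

lemma norm_freq_le (h : SubwavelengthSolution G P Λ γ M ω u) {n : ℤ} (hn : |n| ≤ M) :
    ‖freq ω P.Ω n‖ ≤ (Λ + Λ ^ 2) * P.smallness γ := by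
  have hΛ := h.Λ_pos
  have hΩ := P.Ω_pos
  have h1 : ‖(n : ℂ) * P.Ω‖ ≤ M * P.Ω := by
    rw [norm_mul, Complex.norm_intCast, Complex.norm_real, Real.norm_eq_abs, abs_of_pos hΩ]
    gcongr
    exact_mod_cast hn
  calc ‖freq ω P.Ω n‖ ≤ ‖ω‖ + ‖(n : ℂ) * P.Ω‖ := norm_add_le _ _
    _ ≤ Λ * √P.δ + M * P.Ω := add_le_add h.sub.ω_upper h1
    _ ≤ Λ * P.smallness γ + Λ ^ 2 * P.smallness γ := by
      have := h.sqrt_δ_le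
      have := h.degree_mul_le
      gcongr
    _ = _ := by ring

lemma summable_modeNorm (h : SubwavelengthSolution G P Λ γ M ω u) :
    Summable (modeNorm ω P.Ω u) :=
  h.sub.summable.of_nonneg_of_le (fun _ => ENNReal.toReal_nonneg) fun n =>
    le_mul_of_one_le_left ENNReal.toReal_nonneg (by nlinarith [sq_nonneg ‖freq ω P.Ω n‖])

lemma totalNorm_nonneg (_h : SubwavelengthSolution G P Λ γ M ω u) : 0 ≤ totalNorm ω P.Ω u :=
  tsum_nonneg fun _ => ENNReal.toReal_nonneg

/-- For |n| ≤ M the squared frequency is O(η²), hence O(η) since η ≤ 1. For |n| > M the weight is at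
most 1 + |ω+nΩ|², and the tail hypothesis supplies the factor η. -/
lemma weighted_tsum_le (h : SubwavelengthSolution G P Λ γ M ω u) :
    (Summable fun n => (P.smallness γ + ‖freq ω P.Ω n‖ ^ 2) * modeNorm ω P.Ω u n) ∧
    ∑' n, (P.smallness γ + ‖freq ω P.Ω n‖ ^ 2) * modeNorm ω P.Ω u n ≤
      (1 + (Λ + Λ ^ 2) ^ 2 + Λ) * P.smallness γ * totalNorm ω P.Ω u := by
  have hη := h.smallness_pos
  have hη1 := h.smallness_le_one
  have hΛ := h.Λ_pos
  set η := P.smallness γ with hηd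
  have ha : ∀ n, 0 ≤ modeNorm ω P.Ω u n := fun _ => ENNReal.toReal_nonneg
  set T : ℤ → ℝ := fun n => if (M : ℤ) < |n| then (1 + ‖freq ω P.Ω n‖ ^ 2) * modeNorm ω P.Ω u n
    else 0 with hT
  have hTs : Summable T := by
    refine h.sub.summable.of_nonneg_of_le (fun n => ?_) fun n => ?_
    · simp only [hT]; have := ha n; split_ifs <;> positivity
    · simp only [hT]; have := ha n; split_ifs
      · exact le_rfl
      · positivity
  have hle : ∀ n, (η + ‖freq ω P.Ω n‖ ^ 2) * modeNorm ω P.Ω u n ≤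
      (1 + (Λ + Λ ^ 2) ^ 2) * η * modeNorm ω P.Ω u n + T n := by
    intro n
    have han := ha n
    by_cases hn : (M : ℤ) < |n|
    · simp only [hT, if_pos hn]
      have : 0 ≤ (1 + (Λ + Λ ^ 2) ^ 2) * η * modeNorm ω P.Ω u n := by positivity
      have : (η + ‖freq ω P.Ω n‖ ^ 2) * modeNorm ω P.Ω u n ≤
        (1 + ‖freq ω P.Ω n‖ ^ 2) * modeNorm ω P.Ω u n := by gcongr
      linarith
    · simp only [hT, if_neg hn, add_zero]
      have h1 := h.norm_freq_le (not_lt.1 hn)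
      have h2 : ‖freq ω P.Ω n‖ ^ 2 ≤ (Λ + Λ ^ 2) ^ 2 * η := by
        calc ‖freq ω P.Ω n‖ ^ 2 ≤ ((Λ + Λ ^ 2) * η) ^ 2 := by gcongr
          _ = (Λ + Λ ^ 2) ^ 2 * (η * η) := by ring
          _ ≤ (Λ + Λ ^ 2) ^ 2 * (η * 1) := by gcongr
          _ = _ := by ring
      gcongr
      linarith
  have hs2 : Summable fun n => (1 + (Λ + Λ ^ 2) ^ 2) * η * modeNorm ω P.Ω u n + T n :=
    (h.summable_modeNorm.mul_left _).add hTs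
  have hs1 : Summable fun n => (η + ‖freq ω P.Ω n‖ ^ 2) * modeNorm ω P.Ω u n :=
    hs2.of_nonneg_of_le (fun n => by have := ha n; positivity) hle
  refine ⟨hs1, (hs1.tsum_le_tsum hle hs2).trans ?_⟩
  rw [(h.summable_modeNorm.mul_left _).tsum_add hTs, tsum_mul_left]
  have htail := h.sub.tail
  calc _ ≤ (1 + (Λ + Λ ^ 2) ^ 2) * η * totalNorm ω P.Ω u + Λ * η * totalNorm ω P.Ω u :=
        add_le_add le_rfl htail
    _ = _ := by ring

/-- The constant in the `L²` bound of the majorant. -/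
def majorantConst (Λ : ℝ) : ℝ := 1 + (Λ + Λ ^ 2) ^ 2 + Λ

lemma sqrt_lintegral_sq_mul_enorm (c : ENNReal) (v : ℝ → ℂ)
    (hv : MeasureTheory.AEStronglyMeasurable v) :
    (∫⁻ x, (c * ‖v x‖ₑ) ^ 2) ^ (1 / 2 : ℝ) = c * MeasureTheory.eLpNorm v 2 := by
  simp_rw [mul_pow]
  rw [MeasureTheory.lintegral_const_mul'' _ (hv.enorm.pow_const 2),
    ENNReal.mul_rpow_of_nonneg _ _ (by norm_num),
    MeasureTheory.eLpNorm_eq_lintegral_rpow_enorm_toReal (by norm_num) (by norm_num)]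
  congr 1
  · rw [← ENNReal.rpow_natCast, ← ENNReal.rpow_mul]; norm_num
  · simp

lemma aemeasurable_majorant (h : SubwavelengthSolution G P Λ γ M ω u) (η : ℝ) :
    AEMeasurable (majorant η ω P.Ω u) :=
  AEMeasurable.tsum fun n => ((h.loc n).aestronglyMeasurable.enorm.const_mul _)

lemma lintegral_majorant_sq_le (h : SubwavelengthSolution G P Λ γ M ω u) :
    ∫⁻ x, majorant (P.smallness γ) ω P.Ω u x ^ 2 ≤
      ENNReal.ofReal ((majorantConst Λ * P.smallness γ * totalNorm ω P.Ω u) ^ 2) := by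
  have hη := h.smallness_pos
  obtain ⟨hs, hle⟩ := h.weighted_tsum_le
  refine (lintegral_sq_tsum_le _ fun n =>
    ((h.loc n).aestronglyMeasurable.enorm.const_mul _)).trans ?_
  have h0 : ∀ n, 0 ≤ (P.smallness γ + ‖freq ω P.Ω n‖ ^ 2) * modeNorm ω P.Ω u n := fun n =>
    mul_nonneg (by positivity) ENNReal.toReal_nonneg
  have e : ∀ n, (∫⁻ x, (ENNReal.ofReal (P.smallness γ + ‖freq ω P.Ω n‖ ^ 2) *
      ‖mode ω P.Ω u n x‖ₑ) ^ 2) ^ (1 / 2 : ℝ) =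
      ENNReal.ofReal ((P.smallness γ + ‖freq ω P.Ω n‖ ^ 2) * modeNorm ω P.Ω u n) := by
    intro n
    rw [sqrt_lintegral_sq_mul_enorm _ _ (h.loc n).aestronglyMeasurable,
      ENNReal.ofReal_mul (by positivity), modeNorm, ENNReal.ofReal_toReal (h.loc n).eLpNorm_ne_top]
  simp_rw [e]
  rw [← ENNReal.ofReal_tsum_of_nonneg h0 hs, ← ENNReal.ofReal_pow (tsum_nonneg h0)]
  exact ENNReal.ofReal_le_ofReal (pow_le_pow_left₀ (tsum_nonneg h0) hle 2)

lemma tsum_sq_lintegral_majorant_le (h : SubwavelengthSolution G P Λ γ M ω u) :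
    ∑' q, (∫⁻ x in Set.Ioc (G.xp q) (G.xp (q + 1)), majorant (P.smallness γ) ω P.Ω u x) ^ 2 ≤
      ENNReal.ofReal (G.L * (majorantConst Λ * P.smallness γ * totalNorm ω P.Ω u) ^ 2) := by
  refine (tsum_sq_lintegral_Ioc_le G.xp_strictMono.monotone G.xp_succ_sub_le
    (h.aemeasurable_majorant _)).trans ?_
  rw [ENNReal.ofReal_mul G.L_pos.le]
  gcongr
  exact h.lintegral_majorant_sq_le

lemma lintegral_majorant_ne_top (h : SubwavelengthSolution G P Λ γ M ω u) (q : ℤ) :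
    ∫⁻ x in Set.Ioc (G.xp q) (G.xp (q + 1)), majorant (P.smallness γ) ω P.Ω u x ≠ ⊤ := by
  have h1 := ne_top_of_le_ne_top ENNReal.ofReal_ne_top h.tsum_sq_lintegral_majorant_le
  have h2 := ENNReal.ne_top_of_tsum_ne_top h1 q
  intro htop
  exact h2 (by simp [htop])

lemma cellMass_sq_tsum_le (h : SubwavelengthSolution G P Λ γ M ω u) :
    (Summable fun q => cellMass G (P.smallness γ) ω P.Ω u q ^ 2) ∧
    ∑' q, cellMass G (P.smallness γ) ω P.Ω u q ^ 2 ≤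
      G.L * (majorantConst Λ * P.smallness γ * totalNorm ω P.Ω u) ^ 2 := by
  have h1 := h.tsum_sq_lintegral_majorant_le
  have h2 := ne_top_of_le_ne_top ENNReal.ofReal_ne_top h1
  have e : (fun q => cellMass G (P.smallness γ) ω P.Ω u q ^ 2) = fun q =>
      ((∫⁻ x in Set.Ioc (G.xp q) (G.xp (q + 1)),
        majorant (P.smallness γ) ω P.Ω u x) ^ 2).toReal := by
    ext q; rw [cellMass, ENNReal.toReal_pow]
  rw [e]
  refine ⟨ENNReal.summable_toReal h2, ?_⟩
  rw [← ENNReal.tsum_toReal_eq (ENNReal.ne_top_of_tsum_ne_top h2)]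
  refine ENNReal.toReal_le_of_le_ofReal ?_ h1
  have := G.L_pos
  positivity

lemma cellMass_le (h : SubwavelengthSolution G P Λ γ M ω u) (q : ℤ) :
    cellMass G (P.smallness γ) ω P.Ω u q ≤
      √G.L * (majorantConst Λ * P.smallness γ * totalNorm ω P.Ω u) := by
  obtain ⟨h1, h2⟩ := h.cellMass_sq_tsum_le
  have h3 := (h1.le_tsum q fun _ _ => sq_nonneg _).trans h2
  have hT := h.totalNorm_nonneg
  have hη := h.smallness_pos
  have hΛ := h.Λ_pos
  have hC : 0 ≤ majorantConst Λ * P.smallness γ * totalNorm ω P.Ω u := by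
    unfold majorantConst; positivity
  rw [← Real.sqrt_sq hC, ← Real.sqrt_mul G.L_pos.le]
  exact Real.le_sqrt_of_sq_le h3

/-! ### Local bounds from the Fourier series in time -/

lemma integral_norm_le_cellMass (h : SubwavelengthSolution G P Λ γ M ω u) {q : ℤ} {a b E : ℝ}
    (hE : 0 ≤ E) (hab : a ≤ b) (ha : G.xp q ≤ a) (hb : b ≤ G.xp (q + 1)) {F : ℝ → ℂ}
    (hF : Continuous F)
    (hle : ∀ x ∈ Set.Ioo a b,
      ‖F x‖ₑ ≤ ENNReal.ofReal E * majorant (P.smallness γ) ω P.Ω u x) :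
    ∫ x in a..b, ‖F x‖ ≤ E * cellMass G (P.smallness γ) ω P.Ω u q := by
  rw [intervalIntegral.integral_of_le hab, MeasureTheory.integral_Ioc_eq_integral_Ioo,
    MeasureTheory.integral_norm_eq_lintegral_enorm hF.aestronglyMeasurable, cellMass]
  have e : E * (∫⁻ x in Set.Ioc (G.xp q) (G.xp (q + 1)),
      majorant (P.smallness γ) ω P.Ω u x).toReal = (ENNReal.ofReal E *
      ∫⁻ x in Set.Ioc (G.xp q) (G.xp (q + 1)), majorant (P.smallness γ) ω P.Ω u x).toReal := by
    rw [ENNReal.toReal_mul, ENNReal.toReal_ofReal hE]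
  rw [e]
  refine ENNReal.toReal_mono
    (ENNReal.mul_ne_top ENNReal.ofReal_ne_top (h.lintegral_majorant_ne_top q)) ?_
  rw [← MeasureTheory.lintegral_const_mul' _ _ ENNReal.ofReal_ne_top]
  refine (MeasureTheory.setLIntegral_mono' measurableSet_Ioo hle).trans ?_
  exact MeasureTheory.lintegral_mono_set fun x hx => ⟨ha.trans_lt hx.1, hx.2.le.trans hb⟩

/-- A common form for u (r = η, c = 1), ∂ₜu (r = η, c = i(ω+nΩ)) and ∂ₜ²u (r = 1, c = (i(ω+nΩ))²).
The weight r is what makes the multiplier fit under η + |ω+nΩ|². -/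
lemma enorm_mul_le_majorant {η : ℝ} {c : ℤ → ℂ} {x t : ℝ} {z : ℂ} {r : ℝ}
    (hr : 0 ≤ r)
    (hz : ‖z‖ₑ ≤ ENNReal.ofReal (Real.exp (-(ω.im * t))) *
      ∑' n, ‖c n * mode ω P.Ω u n x‖ₑ)
    (hc : ∀ n, r * ‖c n‖ ≤ η + ‖freq ω P.Ω n‖ ^ 2) :
    ‖(r : ℂ) * z‖ₑ ≤ ENNReal.ofReal (Real.exp (-(ω.im * t))) * majorant η ω P.Ω u x := by
  rw [enorm_mul]
  refine (mul_le_mul_right hz _).trans ?_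
  rw [mul_left_comm, ← ENNReal.tsum_mul_left]
  refine mul_le_mul_right (ENNReal.tsum_le_tsum fun n => ?_) _
  rw [enorm_mul, ← mul_assoc, ← enorm_mul]
  refine mul_le_mul_left ?_ _
  rw [← ofReal_norm]
  refine ENNReal.ofReal_le_ofReal ?_
  rw [norm_mul, Complex.norm_real, Real.norm_eq_abs, abs_of_nonneg hr]
  exact hc n

lemma contDiff_slice {U : ℝ × ℝ → ℂ} {n : WithTop ℕ∞} (hU : ContDiff ℝ n U) (x : ℝ) :
    ContDiff ℝ n fun τ => U (x, τ) := hU.comp (contDiff_prodMk_right x)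

lemma deriv_slice {U : ℝ × ℝ → ℂ} (hU : Differentiable ℝ U) (x : ℝ) :
    (deriv fun τ => U (x, τ)) = fun τ => partialTime U (x, τ) :=
  funext fun τ => (hasDerivAt_partialTime hU x τ).deriv

/-- Bounds on a `C²` extension `U` of `u` from an interval: the `L¹` norms of `U`, `∂ₜU` and
`∂ₜ²U` on this interval. -/
lemma local_bounds (h : SubwavelengthSolution G P Λ γ M ω u) {q : ℤ} {a b : ℝ}
    (hab : a ≤ b) (ha : G.xp q ≤ a) (hb : b ≤ G.xp (q + 1)) {U : ℝ × ℝ → ℂ}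
    (hU : ContDiff ℝ 2 U) (hu : ∀ x ∈ Set.Ioo a b, ∀ t, u x t = U (x, t)) (t : ℝ) :
    P.smallness γ * (∫ x in a..b, ‖U (x, t)‖) ≤
        Real.exp (-(ω.im * t)) * cellMass G (P.smallness γ) ω P.Ω u q ∧
      P.smallness γ * (∫ x in a..b, ‖partialTime U (x, t)‖) ≤
        Real.exp (-(ω.im * t)) * cellMass G (P.smallness γ) ω P.Ω u q ∧
      (∫ x in a..b, ‖partialTime (partialTime U) (x, t)‖) ≤
        Real.exp (-(ω.im * t)) * cellMass G (P.smallness γ) ω P.Ω u q := by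
  have hη := h.smallness_pos
  have hη1 := h.smallness_le_one
  set η := P.smallness γ with hηd
  have hU1 : ContDiff ℝ 1 (partialTime U) := contDiff_partialTime (n := 1) (by norm_num; exact hU)
  have hU2 : ContDiff ℝ 0 (partialTime (partialTime U)) :=
    contDiff_partialTime (n := 0) (by norm_num; exact hU1)
  have hc0 := hU.continuous
  have hc1 := hU1.continuous
  have hc2 := hU2.continuous
  have hd0 : Differentiable ℝ U := hU.differentiable two_ne_zero
  have hd1 : Differentiable ℝ (partialTime U) := hU1.differentiable one_ne_zero
  have hq : ∀ x ∈ Set.Ioo a b, QuasiPeriodic ω P.Ω (fun τ => U (x, τ)) := by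
    intro x hx
    have := h.quasi x
    simp only [hu x hx] at this
    exact this
  have hm : ∀ x ∈ Set.Ioo a b, ∀ n, timeCoeff ω P.Ω (fun τ => U (x, τ)) n = mode ω P.Ω u n x := by
    intro x hx n
    simp only [timeCoeff, mode, hu x hx]
  have hq1 : ∀ x ∈ Set.Ioo a b, QuasiPeriodic ω P.Ω (fun τ => partialTime U (x, τ)) := by
    intro x hx
    have := (hq x hx).deriv
    rwa [deriv_slice hd0] at this
  have hm1 : ∀ x ∈ Set.Ioo a b, ∀ n, timeCoeff ω P.Ω (fun τ => partialTime U (x, τ)) n =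
      Complex.I * freq ω P.Ω n * mode ω P.Ω u n x := by
    intro x hx n
    rw [← hm x hx n, ← timeCoeff_deriv P.Ω_pos (hq x hx)
        (contDiff_slice (hU.of_le (by norm_num)) x),
      deriv_slice hd0]
  have hq2 : ∀ x ∈ Set.Ioo a b,
      QuasiPeriodic ω P.Ω (fun τ => partialTime (partialTime U) (x, τ)) := by
    intro x hx
    have := (hq1 x hx).deriv
    rwa [deriv_slice hd1] at this
  have hm2 : ∀ x ∈ Set.Ioo a b, ∀ n,
      timeCoeff ω P.Ω (fun τ => partialTime (partialTime U) (x, τ)) n =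
      (Complex.I * freq ω P.Ω n) ^ 2 * mode ω P.Ω u n x := by
    intro x hx n
    rw [sq, mul_assoc, ← hm1 x hx n, ← timeCoeff_deriv P.Ω_pos (hq1 x hx) (contDiff_slice hU1 x),
      deriv_slice hd1]
  have hmulint : ∀ F : ℝ → ℂ, η * (∫ x in a..b, ‖F x‖) = ∫ x in a..b, ‖(η : ℂ) * F x‖ := by
    intro F
    rw [← intervalIntegral.integral_const_mul]
    simp [abs_of_pos hη]
  have hE := (Real.exp_pos (-(ω.im * t))).le
  refine ⟨?_, ?_, ?_⟩
  · rw [hmulint]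
    refine h.integral_norm_le_cellMass hE hab ha hb (by fun_prop) fun x hx => ?_
    refine enorm_mul_le_majorant (η := η) (c := fun _ => 1) hη.le ?_ ?_
    · simpa only [hm x hx, one_mul] using
        enorm_le_tsum_timeCoeff P.Ω_pos (hq x hx) (by fun_prop) t
    · intro n; simp
  · rw [hmulint]
    refine h.integral_norm_le_cellMass hE hab ha hb (by fun_prop) fun x hx => ?_
    refine enorm_mul_le_majorant (η := η) (c := fun n => Complex.I * freq ω P.Ω n) hη.le ?_ ?_
    · simpa only [hm1 x hx] using
        enorm_le_tsum_timeCoeff P.Ω_pos (hq1 x hx) (by fun_prop) t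
    · intro n
      rw [norm_mul, Complex.norm_I, one_mul]
      -- From 2|ω+nΩ| ≤ 1 + |ω+nΩ|² and η ≤ 1.
      nlinarith [sq_nonneg (‖freq ω P.Ω n‖ - 1), sq_nonneg ‖freq ω P.Ω n‖,
        norm_nonneg (freq ω P.Ω n)]
  · refine h.integral_norm_le_cellMass hE hab ha hb (by fun_prop) fun x hx => ?_
    have := enorm_mul_le_majorant (P := P) (u := u) (η := η) (x := x) (t := t) (ω := ω)
      (z := partialTime (partialTime U) (x, t)) (r := 1)
      (c := fun n => (Complex.I * freq ω P.Ω n) ^ 2) zero_le_one ?_ ?_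
    · simpa using this
    · simpa only [hm2 x hx] using
        enorm_le_tsum_timeCoeff P.Ω_pos (hq2 x hx) (by fun_prop) t
    · intro n
      rw [norm_pow, norm_mul, Complex.norm_I, one_mul, one_mul]
      linarith

end SubwavelengthSolution

/-! ### Extensions of the solution and transmission conditions -/

lemma iteratedDeriv_two (f : ℝ → ℂ) : iteratedDeriv 2 f = deriv (deriv f) := by
  rw [iteratedDeriv_succ, iteratedDeriv_one]

lemma contDiff_sliceSpace {U : ℝ × ℝ → ℂ} {n : WithTop ℕ∞} (hU : ContDiff ℝ n U) (t : ℝ) :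
    ContDiff ℝ n fun x => U (x, t) := hU.comp (contDiff_prodMk_left t)

lemma deriv_eqOn_Ioo {f g : ℝ → ℂ} {a b : ℝ} (h : ∀ x ∈ Set.Ioo a b, f x = g x) :
    ∀ x ∈ Set.Ioo a b, deriv f x = deriv g x := fun x hx =>
  Filter.EventuallyEq.deriv_eq (by
    filter_upwards [Ioo_mem_nhds hx.1 hx.2] with y hy using h y hy)

lemma partialTime_partialTime_eq {U : ℝ × ℝ → ℂ} (hU : ContDiff ℝ 2 U) (x t : ℝ) :
    deriv (deriv fun τ => U (x, τ)) t = partialTime (partialTime U) (x, t) := by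
  have hU1 : ContDiff ℝ 1 (partialTime U) := contDiff_partialTime (n := 1) (by norm_num; exact hU)
  rw [SubwavelengthSolution.deriv_slice (hU.differentiable two_ne_zero),
    SubwavelengthSolution.deriv_slice (hU1.differentiable one_ne_zero)]

namespace ResonatorArray

variable {N : ℕ} (G : ResonatorArray N)

/-- The cell that contains the `p`-th resonator. -/
def cellOf (p : ℤ) : ℤ := ((resEquiv N G.N_pos).symm p).1

/-- The position in its cell of the `p`-th resonator. -/
def posOf (p : ℤ) : Fin N := ((resEquiv N G.N_pos).symm p).2

@[simp] lemma resIndex_cellOf_posOf (p : ℤ) : resIndex (G.cellOf p) (G.posOf p) = p :=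
  (resEquiv N G.N_pos).apply_symm_apply p

@[simp] lemma cellOf_resIndex (m : ℤ) (i : Fin N) : G.cellOf (resIndex m i) = m :=
  congrArg Prod.fst ((resEquiv N G.N_pos).symm_apply_apply (m, i))

@[simp] lemma posOf_resIndex (m : ℤ) (i : Fin N) : G.posOf (resIndex m i) = i :=
  congrArg Prod.snd ((resEquiv N G.N_pos).symm_apply_apply (m, i))

lemma left_cellOf (p : ℤ) : G.left (G.cellOf p) (G.posOf p) = G.xm p := by simp [left]

lemma right_cellOf (p : ℤ) : G.right (G.cellOf p) (G.posOf p) = G.xp p := by simp [right]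

end ResonatorArray

namespace IsWaveSolution

variable {N : ℕ} {G : ResonatorArray N} {P : Medium N} {u : ℝ → ℝ → ℂ}

/-- A `C²` extension of `u` from the gap after the `p`-th resonator. -/
def gapExt (h : IsWaveSolution G P u) (p : ℤ) : ℝ × ℝ → ℂ := (h.smooth_gap p).choose

/-- A `C²` extension of `u` from the `p`-th resonator. -/
def resExt (h : IsWaveSolution G P u) (p : ℤ) : ℝ × ℝ → ℂ := (h.smooth_resonator p).choose

variable (h : IsWaveSolution G P u)
include h

lemma contDiff_gapExt (p : ℤ) : ContDiff ℝ 2 (h.gapExt p) := (h.smooth_gap p).choose_spec.1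

lemma contDiff_resExt (p : ℤ) : ContDiff ℝ 2 (h.resExt p) :=
  (h.smooth_resonator p).choose_spec.1

lemma eq_gapExt (p : ℤ) : ∀ x ∈ Set.Ioo (G.xp p) (G.xm (p + 1)), ∀ t, u x t = h.gapExt p (x, t) :=
  (h.smooth_gap p).choose_spec.2

lemma eq_resExt (p : ℤ) : ∀ x ∈ Set.Ioo (G.xm p) (G.xp p), ∀ t, u x t = h.resExt p (x, t) :=
  (h.smooth_resonator p).choose_spec.2

lemma traceRight_gap (p : ℤ) (t : ℝ) :
    traceRight (fun y => u y t) (G.xp p) = h.gapExt p (G.xp p, t) :=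
  traceRight_eq (G.lt_gap p) (g := fun y => h.gapExt p (y, t))
    (contDiff_sliceSpace (h.contDiff_gapExt p) t).continuous.continuousAt
    fun x hx => h.eq_gapExt p x hx t

lemma traceLeft_gap (p : ℤ) (t : ℝ) :
    traceLeft (fun y => u y t) (G.xm (p + 1)) = h.gapExt p (G.xm (p + 1), t) :=
  traceLeft_eq (G.lt_gap p) (g := fun y => h.gapExt p (y, t))
    (contDiff_sliceSpace (h.contDiff_gapExt p) t).continuous.continuousAt
    fun x hx => h.eq_gapExt p x hx t

lemma traceRight_res (p : ℤ) (t : ℝ) :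
    traceRight (fun y => u y t) (G.xm p) = h.resExt p (G.xm p, t) :=
  traceRight_eq (G.lt_resonator p) (g := fun y => h.resExt p (y, t))
    (contDiff_sliceSpace (h.contDiff_resExt p) t).continuous.continuousAt
    fun x hx => h.eq_resExt p x hx t

lemma traceLeft_res (p : ℤ) (t : ℝ) :
    traceLeft (fun y => u y t) (G.xp p) = h.resExt p (G.xp p, t) :=
  traceLeft_eq (G.lt_resonator p) (g := fun y => h.resExt p (y, t))
    (contDiff_sliceSpace (h.contDiff_resExt p) t).continuous.continuousAt
    fun x hx => h.eq_resExt p x hx t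

lemma traceRight_deriv_gap (p : ℤ) (t : ℝ) :
    traceRight (deriv fun y => u y t) (G.xp p) = deriv (fun y => h.gapExt p (y, t)) (G.xp p) :=
  traceRight_eq (G.lt_gap p)
    ((contDiff_sliceSpace (h.contDiff_gapExt p) t).continuous_deriv (by norm_num)).continuousAt
    (deriv_eqOn_Ioo fun x hx => h.eq_gapExt p x hx t)

lemma traceLeft_deriv_gap (p : ℤ) (t : ℝ) :
    traceLeft (deriv fun y => u y t) (G.xm (p + 1)) =
      deriv (fun y => h.gapExt p (y, t)) (G.xm (p + 1)) :=
  traceLeft_eq (G.lt_gap p)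
    ((contDiff_sliceSpace (h.contDiff_gapExt p) t).continuous_deriv (by norm_num)).continuousAt
    (deriv_eqOn_Ioo fun x hx => h.eq_gapExt p x hx t)

lemma traceRight_deriv_res (p : ℤ) (t : ℝ) :
    traceRight (deriv fun y => u y t) (G.xm p) = deriv (fun y => h.resExt p (y, t)) (G.xm p) :=
  traceRight_eq (G.lt_resonator p)
    ((contDiff_sliceSpace (h.contDiff_resExt p) t).continuous_deriv (by norm_num)).continuousAt
    (deriv_eqOn_Ioo fun x hx => h.eq_resExt p x hx t)

lemma traceLeft_deriv_res (p : ℤ) (t : ℝ) :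
    traceLeft (deriv fun y => u y t) (G.xp p) = deriv (fun y => h.resExt p (y, t)) (G.xp p) :=
  traceLeft_eq (G.lt_resonator p)
    ((contDiff_sliceSpace (h.contDiff_resExt p) t).continuous_deriv (by norm_num)).continuousAt
    (deriv_eqOn_Ioo fun x hx => h.eq_resExt p x hx t)

lemma gapExt_left (p : ℤ) (t : ℝ) :
    h.gapExt p (G.xp p, t) = (1 / P.s (G.posOf p) t : ℂ) * h.resExt p (G.xp p, t) := by
  have := h.trace_right (G.cellOf p) (G.posOf p) t
  rwa [G.right_cellOf, h.traceRight_gap, h.traceLeft_res] at this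

lemma gapExt_right (p : ℤ) (t : ℝ) :
    h.gapExt p (G.xm (p + 1), t) =
      (1 / P.s (G.posOf (p + 1)) t : ℂ) * h.resExt (p + 1) (G.xm (p + 1), t) := by
  have := h.trace_left (G.cellOf (p + 1)) (G.posOf (p + 1)) t
  rwa [G.left_cellOf, h.traceLeft_gap, h.traceRight_res] at this

/-- Since s_i does not vanish, the flux condition can be solved for the interior derivative. The
contrast then appears as a small factor in front of the exterior derivative. -/
lemma deriv_resExt_right (p : ℤ) (t : ℝ) :
    deriv (fun y => h.resExt p (y, t)) (G.xp p) =
      P.s (G.posOf p) t * P.δd (G.cellOf p) * deriv (fun y => h.gapExt p (y, t)) (G.xp p) := by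
  have := h.flux_right (G.cellOf p) (G.posOf p) t
  rw [G.right_cellOf, h.traceRight_deriv_gap, h.traceLeft_deriv_res] at this
  have hs : (P.s (G.posOf p) t : ℂ) ≠ 0 := by exact_mod_cast P.s_ne _ _
  rw [mul_assoc, this]
  field_simp

lemma deriv_resExt_left (p : ℤ) (t : ℝ) :
    deriv (fun y => h.resExt (p + 1) (y, t)) (G.xm (p + 1)) =
      P.s (G.posOf (p + 1)) t * P.δd (G.cellOf (p + 1)) *
        deriv (fun y => h.gapExt p (y, t)) (G.xm (p + 1)) := by
  have := h.flux_left (G.cellOf (p + 1)) (G.posOf (p + 1)) t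
  rw [G.left_cellOf, h.traceLeft_deriv_gap, h.traceRight_deriv_res] at this
  have hs : (P.s (G.posOf (p + 1)) t : ℂ) ≠ 0 := by exact_mod_cast P.s_ne _ _
  rw [mul_assoc, this]
  field_simp

lemma gapExt_wave (p : ℤ) {x : ℝ} (hx : x ∈ Set.Ioo (G.xp p) (G.xm (p + 1))) (t : ℝ) :
    partialTime (partialTime (h.gapExt p)) (x, t) =
      (P.v₀ : ℂ) ^ 2 * deriv (deriv fun y => h.gapExt p (y, t)) x := by
  have := h.exterior p x hx t
  rw [iteratedDeriv_two, iteratedDeriv_two, sub_eq_zero] at this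
  rw [← partialTime_partialTime_eq (h.contDiff_gapExt p),
    ← deriv_eqOn_Ioo (deriv_eqOn_Ioo fun y hy => h.eq_gapExt p y hy t) x hx, ← this]
  simp only [h.eq_gapExt p x hx]

lemma resExt_wave (hκ : ∀ i, Differentiable ℝ fun t => (1 / P.κ i t : ℂ)) (p : ℤ) {x : ℝ}
    (hx : x ∈ Set.Ioo (G.xm p) (G.xp p)) (t : ℝ) :
    deriv (fun τ => (1 / P.κ (G.posOf p) τ : ℂ)) t * partialTime (h.resExt p) (x, t) +
        (1 / P.κ (G.posOf p) t : ℂ) * partialTime (partialTime (h.resExt p)) (x, t) =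
      (P.vd (G.cellOf p) (G.posOf p) : ℂ) ^ 2 * deriv (deriv fun y => h.resExt p (y, t)) x := by
  have := h.interior (G.cellOf p) (G.posOf p) x
    (by rwa [G.left_cellOf, G.right_cellOf]) t
  rw [iteratedDeriv_two, sub_eq_zero] at this
  rw [← deriv_eqOn_Ioo (deriv_eqOn_Ioo fun y hy => h.eq_resExt p y hy t) x hx, ← this]
  have hU := h.contDiff_resExt p
  have hU1 : ContDiff ℝ 1 (partialTime (h.resExt p)) :=
    contDiff_partialTime (n := 1) (by norm_num; exact hU)
  simp only [h.eq_resExt p x hx]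
  rw [SubwavelengthSolution.deriv_slice (hU.differentiable two_ne_zero)]
  exact (((hκ (G.posOf p) t).hasDerivAt).mul
    (hasDerivAt_partialTime (hU1.differentiable one_ne_zero) x t)).deriv.symm

end IsWaveSolution

/-! ### The modulation `1/κ` -/

namespace SubwavelengthSolution

variable {N : ℕ} {G : ResonatorArray N} {P : Medium N} {Λ γ : ℝ} {M : ℕ} {ω : ℂ}
  {u : ℝ → ℝ → ℂ} (h : SubwavelengthSolution G P Λ γ M ω u)
include h

lemma inv_κ_trig (i : Fin N) : ∃ c : ℤ → ℂ, ∀ t : ℝ, (1 / P.κ i t : ℂ) =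
    ∑ n ∈ Finset.Icc (-(M : ℤ)) M, c n * Complex.exp (Complex.I * n * P.Ω * t) := by
  obtain ⟨c, hc⟩ := h.regime.κ_trig i
  exact ⟨c, fun t => by rw [← hc t]; push_cast; rfl⟩

lemma differentiable_inv_κ (i : Fin N) : Differentiable ℝ fun t => (1 / P.κ i t : ℂ) := by
  obtain ⟨c, hc⟩ := h.inv_κ_trig i
  have : Differentiable ℝ fun t : ℝ => (t : ℂ) := Complex.ofRealCLM.differentiable
  rw [funext hc]
  fun_prop

lemma norm_inv_κ_le (i : Fin N) (t : ℝ) : ‖(1 / P.κ i t : ℂ)‖ ≤ Λ := by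
  have := h.regime.κ_lower i t
  rw [← Real.norm_eq_abs, ← Complex.norm_real] at this
  push_cast at this
  exact this

lemma norm_inv_s_le (i : Fin N) (t : ℝ) : ‖(1 / P.s i t : ℂ)‖ ≤ Λ := by
  have := h.regime.s_lower i t
  rw [← Real.norm_eq_abs, ← Complex.norm_real] at this
  push_cast at this
  exact this

/-- The factor η is indispensable: ∂ₜu is controlled by the mass only after multiplication by η, and
in the interior equation it is multiplied by (1/κ)'. -/
lemma norm_deriv_inv_κ_le (i : Fin N) (t : ℝ) :
    ‖deriv (fun τ => (1 / P.κ i τ : ℂ)) t‖ ≤ (Real.exp 2 + 1) * Λ ^ 3 * P.smallness γ := by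
  obtain ⟨c, hc⟩ := h.inv_κ_trig i
  have hΛ := h.Λ_pos
  refine (norm_deriv_trigPoly_le P.Ω_pos hc (h.norm_inv_κ_le i) t).trans ?_
  calc (Real.exp 2 + 1) * (M * P.Ω * Λ) ≤ (Real.exp 2 + 1) * (Λ ^ 2 * P.smallness γ * Λ) := by
        have := h.degree_mul_le
        gcongr
    _ = _ := by ring

lemma inv_sq_le {v : ℝ} (hv : Λ⁻¹ ≤ v) : (v ^ 2)⁻¹ ≤ Λ ^ 2 := by
  have hΛ := h.Λ_pos
  rw [← inv_pow]
  have h0 : 0 < v := (inv_pos.2 hΛ).trans_le hv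
  gcongr
  exact (inv_le_comm₀ hΛ h0).1 hv

/-! ### Estimates on gaps and resonators -/

/-- The local mass that controls `u` near the `q`-th gap, at time `t`. -/
def mass (G : ResonatorArray N) (P : Medium N) (γ : ℝ) (ω : ℂ) (u : ℝ → ℝ → ℂ) (t : ℝ) (q : ℤ) :
    ℝ :=
  Real.exp (-(ω.im * t)) * cellMass G (P.smallness γ) ω P.Ω u q

omit h in
lemma mass_nonneg (t : ℝ) (q : ℤ) : 0 ≤ mass G P γ ω u t q :=
  mul_nonneg (Real.exp_pos _).le ENNReal.toReal_nonneg

lemma integral_norm_gap_le (p : ℤ) (t : ℝ) :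
    ∫ x in (G.xp p)..(G.xm (p + 1)), ‖deriv (deriv fun y => h.sol.gapExt p (y, t)) x‖ ≤
      Λ ^ 2 * mass G P γ ω u t p := by
  have hU := h.sol.contDiff_gapExt p
  obtain ⟨-, -, h3⟩ := h.local_bounds (G.lt_gap p).le le_rfl (G.lt_resonator (p + 1)).le hU
    (h.sol.eq_gapExt p) t
  have hv0 : 0 < P.v₀ := (inv_pos.2 h.Λ_pos).trans_le h.regime.v₀_lower
  have hv0' : (P.v₀ : ℂ) ≠ 0 := by exact_mod_cast hv0.ne'
  have e : ∫ x in (G.xp p)..(G.xm (p + 1)), ‖deriv (deriv fun y => h.sol.gapExt p (y, t)) x‖ =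
      ∫ x in (G.xp p)..(G.xm (p + 1)),
        (P.v₀ ^ 2)⁻¹ * ‖partialTime (partialTime (h.sol.gapExt p)) (x, t)‖ := by
    refine intervalIntegral.integral_congr_Ioo_of_le (G.lt_gap p).le fun x hx => ?_
    rw [h.sol.gapExt_wave p hx t, norm_mul, norm_pow, Complex.norm_real, Real.norm_eq_abs,
      abs_of_pos hv0]
    field_simp
  rw [e, intervalIntegral.integral_const_mul]
  have h0 : 0 ≤ ∫ x in (G.xp p)..(G.xm (p + 1)),
      ‖partialTime (partialTime (h.sol.gapExt p)) (x, t)‖ :=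
    intervalIntegral.integral_nonneg (G.lt_gap p).le fun _ _ => norm_nonneg _
  exact mul_le_mul (h.inv_sq_le h.regime.v₀_lower) h3 h0 (by positivity)

/-- The constant in the bound of the exterior derivative. -/
def gapConst (g Λ : ℝ) : ℝ := 18 / g ^ 2 + Λ ^ 2

/-- The weight η on the left comes from the bound of u itself in the interpolation. It costs nothing
later, since the exterior derivative enters a resonator multiplied by δ^m = O(η). -/
lemma norm_deriv_gapExt_le {g : ℝ} (hg : 0 < g) (hgap : ∀ p, g ≤ G.gapLen p) (p : ℤ) (t : ℝ)
    {z : ℝ} (hz : z ∈ Set.Icc (G.xp p) (G.xm (p + 1))) :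
    P.smallness γ * ‖deriv (fun y => h.sol.gapExt p (y, t)) z‖ ≤
      gapConst g Λ * mass G P γ ω u t p := by
  have hU := h.sol.contDiff_gapExt p
  have hη := h.smallness_pos
  have hη1 := h.smallness_le_one
  obtain ⟨h1, -, -⟩ := h.local_bounds (G.lt_gap p).le le_rfl (G.lt_resonator (p + 1)).le hU
    (h.sol.eq_gapExt p) t
  have h2 := norm_deriv_le_interpolation (contDiff_sliceSpace hU t) (G.lt_gap p) hz
  have h3 := h.integral_norm_gap_le p t
  have hI : 0 ≤ ∫ x in (G.xp p)..(G.xm (p + 1)), ‖h.sol.gapExt p (x, t)‖ :=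
    intervalIntegral.integral_nonneg (G.lt_gap p).le fun _ _ => norm_nonneg _
  have hm := mass_nonneg (G := G) (P := P) (γ := γ) (ω := ω) (u := u) t p
  have hgp := hgap p
  simp only [ResonatorArray.gapLen] at hgp
  calc _ ≤ P.smallness γ * (18 / g ^ 2 * (∫ x in (G.xp p)..(G.xm (p + 1)),
        ‖h.sol.gapExt p (x, t)‖) + Λ ^ 2 * mass G P γ ω u t p) := by
        gcongr
        refine h2.trans (add_le_add ?_ h3)
        gcongr
    _ = 18 / g ^ 2 * (P.smallness γ * ∫ x in (G.xp p)..(G.xm (p + 1)),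
        ‖h.sol.gapExt p (x, t)‖) + P.smallness γ * (Λ ^ 2 * mass G P γ ω u t p) := by ring
    _ ≤ 18 / g ^ 2 * mass G P γ ω u t p + 1 * (Λ ^ 2 * mass G P γ ω u t p) := by
        gcongr
        exact h1
    _ = _ := by rw [gapConst]; ring

/-- Only the second derivative enters here, so no weight η is lost, in contrast with the bound of
the derivative itself. -/
lemma norm_slope_sub_deriv_le (p : ℤ) (t : ℝ) {z : ℝ}
    (hz : z ∈ Set.Icc (G.xp p) (G.xm (p + 1))) :
    ‖(h.sol.gapExt p (G.xm (p + 1), t) - h.sol.gapExt p (G.xp p, t)) / G.gapLen p -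
      deriv (fun y => h.sol.gapExt p (y, t)) z‖ ≤ Λ ^ 2 * mass G P γ ω u t p := by
  have hU := h.sol.contDiff_gapExt p
  have h1 := norm_sub_linear_le (contDiff_sliceSpace hU t)
    (Set.left_mem_Icc.2 (G.lt_gap p).le) (Set.right_mem_Icc.2 (G.lt_gap p).le) hz
  have hg := G.gapLen_pos p
  have hg' : (G.gapLen p : ℂ) ≠ 0 := by exact_mod_cast hg.ne'
  have e : ((G.xm (p + 1) : ℂ) - G.xp p) = G.gapLen p := by
    rw [ResonatorArray.gapLen]; push_cast; rfl
  rw [e, show |G.xm (p + 1) - G.xp p| = G.gapLen p from abs_of_pos hg] at h1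
  have e2 : (h.sol.gapExt p (G.xm (p + 1), t) - h.sol.gapExt p (G.xp p, t)) / G.gapLen p -
      deriv (fun y => h.sol.gapExt p (y, t)) z =
      (h.sol.gapExt p (G.xm (p + 1), t) - h.sol.gapExt p (G.xp p, t) -
        G.gapLen p * deriv (fun y => h.sol.gapExt p (y, t)) z) / G.gapLen p := by
    field_simp
  rw [e2, norm_div, Complex.norm_real, Real.norm_eq_abs, abs_of_pos hg, div_le_iff₀ hg]
  refine h1.trans ?_
  rw [mul_comm]
  gcongr
  exact h.integral_norm_gap_le p t

/-- The index shift reflects that the mass with index p is taken over gap p together with resonator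
p + 1. -/
lemma integral_norm_res_le (p : ℤ) (t : ℝ) :
    ∫ x in (G.xm (p + 1))..(G.xp (p + 1)),
      ‖deriv (deriv fun y => h.sol.resExt (p + 1) (y, t)) x‖ ≤
      Λ ^ 2 * ((Real.exp 2 + 1) * Λ ^ 3 + Λ) * mass G P γ ω u t p := by
  have hΛ := h.Λ_pos
  have hU := h.sol.contDiff_resExt (p + 1)
  have hU1 : ContDiff ℝ 1 (partialTime (h.sol.resExt (p + 1))) :=
    contDiff_partialTime (n := 1) (by norm_num; exact hU)
  have hU2 : ContDiff ℝ 0 (partialTime (partialTime (h.sol.resExt (p + 1)))) :=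
    contDiff_partialTime (n := 0) (by norm_num; exact hU1)
  have hc1 := hU1.continuous
  have hc2 := hU2.continuous
  have hη := h.smallness_pos
  obtain ⟨-, h2, h3⟩ := h.local_bounds (G.lt_resonator (p + 1)).le (G.lt_gap p).le le_rfl hU
    (h.sol.eq_resExt (p + 1)) t
  set i := G.posOf (p + 1)
  set v := P.vd (G.cellOf (p + 1)) i with hvdef
  have hvl : Λ⁻¹ ≤ v := h.regime.vd_lower _ _
  have hv0 : 0 < v := (inv_pos.2 hΛ).trans_le hvl
  have hv0' : (v : ℂ) ≠ 0 := by exact_mod_cast hv0.ne'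
  set k' : ℂ := deriv (fun τ => (1 / P.κ i τ : ℂ)) t
  set k : ℂ := (1 / P.κ i t : ℂ)
  have e : ∫ x in (G.xm (p + 1))..(G.xp (p + 1)),
      ‖deriv (deriv fun y => h.sol.resExt (p + 1) (y, t)) x‖ =
      ∫ x in (G.xm (p + 1))..(G.xp (p + 1)), (v ^ 2)⁻¹ *
        ‖k' * partialTime (h.sol.resExt (p + 1)) (x, t) +
          k * partialTime (partialTime (h.sol.resExt (p + 1))) (x, t)‖ := by
    refine intervalIntegral.integral_congr_Ioo_of_le (G.lt_resonator _).le fun x hx => ?_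
    rw [h.sol.resExt_wave h.differentiable_inv_κ (p + 1) hx t, norm_mul, norm_pow,
      Complex.norm_real, Real.norm_eq_abs, abs_of_pos hv0]
    field_simp
  rw [e, intervalIntegral.integral_const_mul]
  have hle : ∫ x in (G.xm (p + 1))..(G.xp (p + 1)),
      ‖k' * partialTime (h.sol.resExt (p + 1)) (x, t) +
        k * partialTime (partialTime (h.sol.resExt (p + 1))) (x, t)‖ ≤
      ((Real.exp 2 + 1) * Λ ^ 3 + Λ) * mass G P γ ω u t p := by
    calc _ ≤ ∫ x in (G.xm (p + 1))..(G.xp (p + 1)), ((Real.exp 2 + 1) * Λ ^ 3 *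
          (P.smallness γ * ‖partialTime (h.sol.resExt (p + 1)) (x, t)‖) +
          Λ * ‖partialTime (partialTime (h.sol.resExt (p + 1))) (x, t)‖) := by
          refine intervalIntegral.integral_mono_on (G.lt_resonator _).le
            (Continuous.intervalIntegrable (by fun_prop) _ _)
            (Continuous.intervalIntegrable (by fun_prop) _ _) fun x _ => ?_
          refine (norm_add_le _ _).trans ?_
          rw [norm_mul, norm_mul, ← mul_assoc]
          have a1 := h.norm_deriv_inv_κ_le i t
          have a2 := h.norm_inv_κ_le i t
          gcongr
      _ = (Real.exp 2 + 1) * Λ ^ 3 * (P.smallness γ * ∫ x in (G.xm (p + 1))..(G.xp (p + 1)),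
          ‖partialTime (h.sol.resExt (p + 1)) (x, t)‖) +
          Λ * ∫ x in (G.xm (p + 1))..(G.xp (p + 1)),
            ‖partialTime (partialTime (h.sol.resExt (p + 1))) (x, t)‖ := by
          rw [intervalIntegral.integral_add (Continuous.intervalIntegrable (by fun_prop) _ _)
            (Continuous.intervalIntegrable (by fun_prop) _ _),
            intervalIntegral.integral_const_mul, intervalIntegral.integral_const_mul,
            intervalIntegral.integral_const_mul]
      _ ≤ (Real.exp 2 + 1) * Λ ^ 3 * mass G P γ ω u t p + Λ * mass G P γ ω u t p := by
          gcongr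
          · exact h2
          · exact h3
      _ = _ := by ring
  have h0 : 0 ≤ ∫ x in (G.xm (p + 1))..(G.xp (p + 1)),
      ‖k' * partialTime (h.sol.resExt (p + 1)) (x, t) +
        k * partialTime (partialTime (h.sol.resExt (p + 1))) (x, t)‖ :=
    intervalIntegral.integral_nonneg (G.lt_resonator _).le fun _ _ => norm_nonneg _
  rw [mul_assoc]
  exact mul_le_mul (h.inv_sq_le hvl) hle h0 (by positivity)

/-- The constant in the bound of the interior derivative. -/
def resConst (g Λ : ℝ) : ℝ :=
  Λ ^ 2 * gapConst g Λ + Λ ^ 2 * ((Real.exp 2 + 1) * Λ ^ 3 + Λ)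

/-- The derivative at the left end is s_i δ^m times the exterior one, hence O(η) times it; the L¹
bound of the second derivative spreads this estimate over the resonator. -/
lemma norm_deriv_resExt_le {g : ℝ} (hg : 0 < g) (hgap : ∀ p, g ≤ G.gapLen p) (p : ℤ) (t : ℝ)
    {z : ℝ} (hz : z ∈ Set.Icc (G.xm (p + 1)) (G.xp (p + 1))) :
    ‖deriv (fun y => h.sol.resExt (p + 1) (y, t)) z‖ ≤ resConst g Λ * mass G P γ ω u t p := by
  have hΛ := h.Λ_pos
  have hδ := P.δ_pos
  have hU := h.sol.contDiff_resExt (p + 1)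
  have h1 := norm_deriv_sub_deriv_le (contDiff_sliceSpace hU t)
    (Set.left_mem_Icc.2 (G.lt_resonator (p + 1)).le) hz
  have h2 := h.integral_norm_res_le p t
  have h3 := h.norm_deriv_gapExt_le hg hgap p t (Set.right_mem_Icc.2 (G.lt_gap p).le)
  have h4 := h.sol.deriv_resExt_left p t
  set d := deriv (fun y => h.sol.gapExt p (y, t)) (G.xm (p + 1))
  have h5 : ‖deriv (fun y => h.sol.resExt (p + 1) (y, t)) (G.xm (p + 1))‖ ≤
      Λ ^ 2 * gapConst g Λ * mass G P γ ω u t p := by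
    rw [h4, norm_mul, norm_mul, Complex.norm_real, Complex.norm_real, Real.norm_eq_abs,
      Real.norm_eq_abs, abs_of_pos (P.δd_pos _)]
    calc _ ≤ Λ * (Λ * P.δ) * ‖d‖ := by
          have b1 := h.regime.s_upper (G.posOf (p + 1)) t
          have b2 := h.regime.δd_upper (G.cellOf (p + 1))
          have b3 := (P.δd_pos (G.cellOf (p + 1))).le
          gcongr
      _ ≤ Λ * (Λ * P.smallness γ) * ‖d‖ := by
          have := h.δ_le_smallness
          gcongr
      _ = Λ ^ 2 * (P.smallness γ * ‖d‖) := by ring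
      _ ≤ Λ ^ 2 * (gapConst g Λ * mass G P γ ω u t p) := by gcongr
      _ = _ := by ring
  have h6 := norm_le_norm_add_norm_sub' (deriv (fun y => h.sol.resExt (p + 1) (y, t)) z)
    (deriv (fun y => h.sol.resExt (p + 1) (y, t)) (G.xm (p + 1)))
  have e : resConst g Λ * mass G P γ ω u t p = Λ ^ 2 * gapConst g Λ * mass G P γ ω u t p +
    Λ ^ 2 * ((Real.exp 2 + 1) * Λ ^ 3 + Λ) * mass G P γ ω u t p := by rw [resConst]; ring
  linarith

/-- The mean value of `u(·, t)` on the `p`-th resonator. -/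
def mean (p : ℤ) (t : ℝ) : ℂ :=
  ((G.xp p - G.xm p)⁻¹ : ℝ) * ∫ x in (G.xm p)..(G.xp p), h.sol.resExt p (x, t)

lemma norm_resExt_sub_mean_le {g : ℝ} (hg : 0 < g) (hgap : ∀ p, g ≤ G.gapLen p) (p : ℤ) (t : ℝ)
    {x : ℝ} (hx : x ∈ Set.Icc (G.xm (p + 1)) (G.xp (p + 1))) :
    ‖h.sol.resExt (p + 1) (x, t) - h.mean (p + 1) t‖ ≤
      G.L * resConst g Λ * mass G P γ ω u t p := by
  have hU := h.sol.contDiff_resExt (p + 1)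
  have h0 := fun z hz => h.norm_deriv_resExt_le hg hgap p t (z := z) hz
  refine (norm_sub_average_le (contDiff_sliceSpace (hU.of_le (by norm_num)) t)
    (G.lt_resonator (p + 1)) hx h0).trans ?_
  rw [mul_assoc]
  have hn := (norm_nonneg _).trans (h0 x hx)
  have hL : G.xp (p + 1) - G.xm (p + 1) ≤ G.L := by
    have := G.xp_succ_sub_le p
    have := G.lt_gap p
    linarith
  gcongr

/-- The exterior trace associated with the mean value on the `p`-th resonator. -/
def scaledMean (t : ℝ) (p : ℤ) : ℂ := (1 / P.s (G.posOf p) t : ℂ) * h.mean p t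

/-- The constant in the comparison of exterior derivatives with difference quotients. -/
def slopeConst (G : ResonatorArray N) (g Λ : ℝ) : ℝ := Λ * G.L * resConst g Λ / g + Λ ^ 2

/-- The end values of u on gap p are replaced by means on resonators p and p + 1, which are
controlled by the masses with indices p - 1 and p respectively. -/
lemma norm_scaledMean_slope_le {g : ℝ} (hg : 0 < g) (hgap : ∀ p, g ≤ G.gapLen p) (p : ℤ) (t : ℝ)
    {z : ℝ} (hz : z ∈ Set.Icc (G.xp p) (G.xm (p + 1))) :
    ‖(h.scaledMean t (p + 1) - h.scaledMean t p) / G.gapLen p -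
      deriv (fun y => h.sol.gapExt p (y, t)) z‖ ≤
      slopeConst G g Λ * (mass G P γ ω u t (p - 1) + mass G P γ ω u t p) := by
  have hΛ := h.Λ_pos
  have hL := G.L_pos
  have hgp := G.gapLen_pos p
  have m0 := mass_nonneg (G := G) (P := P) (γ := γ) (ω := ω) (u := u) t p
  have m1 := mass_nonneg (G := G) (P := P) (γ := γ) (ω := ω) (u := u) t (p - 1)
  have hR : 0 ≤ resConst g Λ := by unfold resConst gapConst; positivity
  have h1 := h.norm_slope_sub_deriv_le p t hz
  have h2 : ‖h.scaledMean t (p + 1) - h.sol.gapExt p (G.xm (p + 1), t)‖ ≤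
      Λ * (G.L * resConst g Λ * mass G P γ ω u t p) := by
    rw [scaledMean, h.sol.gapExt_right, ← mul_sub, norm_mul, norm_sub_rev]
    exact mul_le_mul (h.norm_inv_s_le _ _) (h.norm_resExt_sub_mean_le hg hgap p t
      (Set.left_mem_Icc.2 (G.lt_resonator _).le)) (norm_nonneg _) hΛ.le
  have h3 : ‖h.scaledMean t p - h.sol.gapExt p (G.xp p, t)‖ ≤
      Λ * (G.L * resConst g Λ * mass G P γ ω u t (p - 1)) := by
    rw [scaledMean, h.sol.gapExt_left, ← mul_sub, norm_mul, norm_sub_rev]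
    have := h.norm_resExt_sub_mean_le hg hgap (p - 1) t (x := G.xp p)
    rw [sub_add_cancel] at this
    exact mul_le_mul (h.norm_inv_s_le _ _) (this
      (Set.right_mem_Icc.2 (G.lt_resonator _).le)) (norm_nonneg _) hΛ.le
  have e : (h.scaledMean t (p + 1) - h.scaledMean t p) / G.gapLen p -
      deriv (fun y => h.sol.gapExt p (y, t)) z =
      ((h.scaledMean t (p + 1) - h.sol.gapExt p (G.xm (p + 1), t)) -
        (h.scaledMean t p - h.sol.gapExt p (G.xp p, t))) / G.gapLen p +
      ((h.sol.gapExt p (G.xm (p + 1), t) - h.sol.gapExt p (G.xp p, t)) / G.gapLen p -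
        deriv (fun y => h.sol.gapExt p (y, t)) z) := by ring
  rw [e]
  refine (norm_add_le _ _).trans ?_
  rw [norm_div, Complex.norm_real, Real.norm_eq_abs, abs_of_pos hgp]
  calc _ ≤ (Λ * (G.L * resConst g Λ * mass G P γ ω u t p) +
        Λ * (G.L * resConst g Λ * mass G P γ ω u t (p - 1))) / g +
        Λ ^ 2 * mass G P γ ω u t p := by
        have := hgap p
        gcongr
        exact (norm_sub_le _ _).trans (add_le_add h2 h3)
    _ ≤ (Λ * (G.L * resConst g Λ * mass G P γ ω u t p) +
        Λ * (G.L * resConst g Λ * mass G P γ ω u t (p - 1))) / g +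
        Λ ^ 2 * (mass G P γ ω u t (p - 1) + mass G P γ ω u t p) := by
        gcongr; linarith
    _ = _ := by rw [slopeConst]; ring

end SubwavelengthSolution

/-- Square summability passes to a family bounded by three consecutive terms. -/
lemma tsum_sq_le_of_le_three_term {κ : Type*} (e : κ ≃ ℤ) {r : κ → ℝ} {a : ℤ → ℝ} {c B : ℝ}
    (hr : ∀ q, 0 ≤ r q) (hra : ∀ q, r q ≤ c * (a (e q - 2) + a (e q - 1) + a (e q)))
    (ha : Summable fun p => a p ^ 2) (hB : ∑' p, a p ^ 2 ≤ B ^ 2) :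
    (Summable fun q => r q ^ 2) ∧ ∑' q, r q ^ 2 ≤ (3 * c * B) ^ 2 := by
  have hs : ∀ k : ℤ, (Summable fun p => a (p - k) ^ 2) ∧
      ∑' p, a (p - k) ^ 2 = ∑' p, a p ^ 2 := by
    intro k
    constructor
    · have := (Equiv.subRight k).summable_iff (f := fun p => a p ^ 2)
      simp only [Function.comp_def, Equiv.subRight_apply] at this
      exact this.2 ha
    · have := (Equiv.subRight k).tsum_eq fun p => a p ^ 2
      simpa only [Equiv.subRight_apply] using this
  obtain ⟨ha2, ht2⟩ := hs 2
  obtain ⟨ha1, ht1⟩ := hs 1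
  set F : ℤ → ℝ := fun p => 3 * c ^ 2 * (a (p - 2) ^ 2 + a (p - 1) ^ 2 + a p ^ 2) with hF
  have hFs : Summable F := ((ha2.add ha1).add ha).mul_left _
  have hrF : ∀ q, r q ^ 2 ≤ F (e q) := by
    intro q
    have hq := hra q
    generalize e q = p at hq ⊢
    calc r q ^ 2 ≤ (c * (a (p - 2) + a (p - 1) + a p)) ^ 2 := pow_le_pow_left₀ (hr q) hq 2
      _ = c ^ 2 * (a (p - 2) + a (p - 1) + a p) ^ 2 := mul_pow _ _ _
      _ ≤ c ^ 2 * (3 * (a (p - 2) ^ 2 + a (p - 1) ^ 2 + a p ^ 2)) := by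
        -- (x+y+z)² ≤ 3(x²+y²+z²). Together with the three shifts, whose sums agree, this produces
        -- 9c² = (3c)².
        refine mul_le_mul_of_nonneg_left ?_ (sq_nonneg c)
        linarith [sq_nonneg (a (p - 2) - a (p - 1)), sq_nonneg (a (p - 1) - a p),
          sq_nonneg (a (p - 2) - a p)]
      _ = F p := by rw [hF]; ring
  have hFe : Summable fun q => F (e q) := e.summable_iff.2 hFs
  have hsum := hFe.of_nonneg_of_le (fun _ => sq_nonneg _) hrF
  refine ⟨hsum, (hsum.tsum_le_tsum hrF hFe).trans ?_⟩
  rw [e.tsum_eq F, hF, tsum_mul_left, (ha2.add ha1).tsum_add ha, ha2.tsum_add ha1, ht1, ht2]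
  calc _ = 9 * c ^ 2 * ∑' p, a p ^ 2 := by ring
    _ ≤ 9 * c ^ 2 * B ^ 2 := by gcongr
    _ = _ := by ring

namespace SubwavelengthSolution

variable {N : ℕ} {G : ResonatorArray N} {P : Medium N} {Λ γ : ℝ} {M : ℕ} {ω : ℂ}
  {u : ℝ → ℝ → ℂ} (h : SubwavelengthSolution G P Λ γ M ω u)

/-! ### The cell vectors are the mean values of the solution -/

include h

lemma contDiff_partialTime_resExt (p : ℤ) : ContDiff ℝ 1 (partialTime (h.sol.resExt p)) :=
  contDiff_partialTime (n := 1) (by norm_num; exact h.sol.contDiff_resExt p)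

lemma hasDerivAt_mean (p : ℤ) (t : ℝ) :
    HasDerivAt (h.mean p) (((G.xp p - G.xm p)⁻¹ : ℝ) *
      ∫ x in (G.xm p)..(G.xp p), partialTime (h.sol.resExt p) (x, t)) t :=
  (hasDerivAt_integral_partialTime ((h.sol.contDiff_resExt p).of_le (by norm_num))
    _ _ t).const_mul _

lemma hasDerivAt_deriv_mean (p : ℤ) (t : ℝ) :
    HasDerivAt (deriv (h.mean p)) (((G.xp p - G.xm p)⁻¹ : ℝ) *
      ∫ x in (G.xm p)..(G.xp p), partialTime (partialTime (h.sol.resExt p)) (x, t)) t := by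
  rw [funext fun τ => (h.hasDerivAt_mean p τ).deriv]
  exact (hasDerivAt_integral_partialTime (h.contDiff_partialTime_resExt p) _ _ t).const_mul _

lemma contDiff_mean (p : ℤ) : ContDiff ℝ 2 (h.mean p) := by
  have h1 : Differentiable ℝ (h.mean p) := fun t => (h.hasDerivAt_mean p t).differentiableAt
  have h2 : Differentiable ℝ (deriv (h.mean p)) :=
    fun t => (h.hasDerivAt_deriv_mean p t).differentiableAt
  have h3 : Continuous (deriv (deriv (h.mean p))) := by
    rw [funext fun τ => (h.hasDerivAt_deriv_mean p τ).deriv]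
    have hc : Continuous (partialTime (partialTime (h.sol.resExt p))) :=
      (contDiff_partialTime (n := 0)
        (by norm_num; exact h.contDiff_partialTime_resExt p)).continuous
    exact continuous_const.mul (intervalIntegral.continuous_parametric_intervalIntegral_of_continuous'
      (f := fun τ x => partialTime (partialTime (h.sol.resExt p)) (x, τ)) (by fun_prop) _ _)
  rw [show (2 : WithTop ℕ∞) = 1 + 1 by norm_num, contDiff_succ_iff_deriv]
  exact ⟨h1, by simp, contDiff_one_iff_deriv.2 ⟨h2, h3⟩⟩

lemma quasiPeriodic_mean (p : ℤ) : QuasiPeriodic ω P.Ω (h.mean p) := by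
  apply quasiPeriodic_of_shift
  intro t
  have hq : ∀ x ∈ Set.Ioo (G.xm p) (G.xp p), h.sol.resExt p (x, t + 2 * Real.pi / P.Ω) =
      Complex.exp (Complex.I * ω * (2 * Real.pi / P.Ω : ℝ)) * h.sol.resExt p (x, t) := by
    intro x hx
    rw [← h.sol.eq_resExt p x hx, ← h.sol.eq_resExt p x hx]
    exact QuasiPeriodic.shift (h.quasi x) t
  simp only [mean]
  rw [intervalIntegral.integral_congr_Ioo_of_le (G.lt_resonator p).le fun x hx => hq x hx,
    intervalIntegral.integral_const_mul]
  ring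

/-- Fubini for the averages over the resonator and over one period, applied to the extension, which
is continuous on the closed rectangle. -/
lemma timeCoeff_mean (m : ℤ) (i : Fin N) (n : ℤ) :
    timeCoeff ω P.Ω (h.mean (resIndex m i)) n = modeVec G ω P.Ω u n m i := by
  have hc := (h.sol.contDiff_resExt (resIndex m i)).continuous
  have e1 : ∫ x in (G.left m i)..(G.right m i), mode ω P.Ω u n x =
      ∫ x in (G.left m i)..(G.right m i), (P.Ω / (2 * Real.pi) : ℝ) *
        ∫ t in (0 : ℝ)..(2 * Real.pi / P.Ω), h.sol.resExt (resIndex m i) (x, t) *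
          Complex.exp (-(Complex.I * freq ω P.Ω n * t)) := by
    refine intervalIntegral.integral_congr_Ioo_of_le (G.lt_resonator _).le fun x hx => ?_
    simp only [mode, h.sol.eq_resExt (resIndex m i) x hx]
  simp only [modeVec, timeCoeff, mean]
  rw [e1, intervalIntegral.integral_const_mul,
    MeasureTheory.intervalIntegral_intervalIntegral_swap]
  · rw [mul_left_comm]
    congr 1
    rw [← intervalIntegral.integral_const_mul]
    refine intervalIntegral.integral_congr fun t _ => ?_
    rw [intervalIntegral.integral_mul_const, mul_assoc, ← G.len_eq m i]
    rfl
  · refine (ContinuousOn.integrableOn_compact (isCompact_uIcc.prod isCompact_uIcc)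
      (Continuous.continuousOn ?_)).mono_set
        (Set.prod_mono Set.uIoc_subset_uIcc Set.uIoc_subset_uIcc)
    simp only [Function.uncurry_def]
    fun_prop

lemma norm_modeVec_le (n m : ℤ) (i : Fin N) :
    ‖modeVec G ω P.Ω u n m i‖ ≤ (G.len i)⁻¹ * (√G.L * modeNorm ω P.Ω u n) := by
  have hl := G.len_pos i
  have hL := G.L_pos
  have hlr : G.left m i ≤ G.right m i := (G.lt_resonator _).le
  rw [modeVec, norm_mul, Complex.norm_real, Real.norm_eq_abs, abs_of_pos (inv_pos.2 hl)]
  gcongr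
  have hloc := h.loc n
  have h1 := sq_lintegral_Ioc_le hloc.aestronglyMeasurable.enorm
    (a := G.left m i) (b := G.right m i) (L := G.L) (by rw [G.len_eq]; exact G.len_le i)
  have h2 : ∫⁻ x in Set.Ioc (G.left m i) (G.right m i), ‖mode ω P.Ω u n x‖ₑ ^ 2 ≤
      MeasureTheory.eLpNorm (mode ω P.Ω u n) 2 ^ 2 := by
    have := sqrt_lintegral_sq_mul_enorm 1 _ hloc.aestronglyMeasurable
    simp only [one_mul] at this
    rw [← this, ← ENNReal.rpow_natCast, ← ENNReal.rpow_mul]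
    norm_num
    exact MeasureTheory.setLIntegral_le_lintegral _ _
  have h3 : (∫⁻ x in Set.Ioc (G.left m i) (G.right m i), ‖mode ω P.Ω u n x‖ₑ) ^ 2 ≤
      ENNReal.ofReal (G.L * modeNorm ω P.Ω u n ^ 2) := by
    refine h1.trans ?_
    rw [ENNReal.ofReal_mul hL.le, modeNorm, ENNReal.ofReal_pow ENNReal.toReal_nonneg,
      ENNReal.ofReal_toReal hloc.eLpNorm_ne_top]
    gcongr
  rw [intervalIntegral.integral_of_le hlr]
  have h4 := MeasureTheory.enorm_integral_le_lintegral_enorm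
    (μ := MeasureTheory.volume.restrict (Set.Ioc (G.left m i) (G.right m i))) (mode ω P.Ω u n)
  have h5 := (pow_le_pow_left' h4 2).trans h3
  rw [← ofReal_norm, ← ENNReal.ofReal_pow (norm_nonneg _),
    ENNReal.ofReal_le_ofReal_iff (by positivity)] at h5
  have hn : 0 ≤ modeNorm ω P.Ω u n := ENNReal.toReal_nonneg
  calc _ ≤ √(G.L * modeNorm ω P.Ω u n ^ 2) := Real.le_sqrt_of_sq_le h5
    _ = _ := by rw [Real.sqrt_mul hL.le, Real.sqrt_sq hn]

lemma summable_norm_modeVec (m : ℤ) : Summable fun k => ‖modeVec G ω P.Ω u k m‖ := by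
  obtain ⟨l, hl0, hl⟩ := G.exists_len_lower
  refine (h.summable_modeNorm.mul_left (l⁻¹ * √G.L)).of_nonneg_of_le (fun _ => norm_nonneg _)
    fun k => ?_
  have hn : 0 ≤ modeNorm ω P.Ω u k := ENNReal.toReal_nonneg
  rw [pi_norm_le_iff_of_nonneg (by positivity)]
  intro i
  refine (h.norm_modeVec_le k m i).trans ?_
  rw [mul_assoc]
  gcongr
  exact hl i

/-- Fourier inversion for the mean, whose coefficients are summable because their size is bounded by
the L² norms of the modes. Smoothness of the cell vectors is then inherited from u and needs no
termwise differentiation. -/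
lemma cellVec_eq_mean (m : ℤ) (t : ℝ) (i : Fin N) :
    cellVec G ω P.Ω u m t i = h.mean (resIndex m i) t := by
  have hs : Summable (timeCoeff ω P.Ω (h.mean (resIndex m i))) := by
    refine Summable.of_norm ((h.summable_norm_modeVec m).of_nonneg_of_le
      (fun _ => norm_nonneg _) fun k => ?_)
    rw [h.timeCoeff_mean]
    exact norm_le_pi_norm (modeVec G ω P.Ω u k m) i
  have := hasSum_timeCoeff P.Ω_pos (h.quasiPeriodic_mean _) (h.contDiff_mean _).continuous hs t
  simp only [h.timeCoeff_mean] at this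
  exact this.tsum_eq

lemma contDiff_cellVec (m : ℤ) : ContDiff ℝ 2 (cellVec G ω P.Ω u m) := by
  rw [contDiff_pi]
  intro i
  simp only [h.cellVec_eq_mean]
  exact h.contDiff_mean _

/-! ### The defect of the capacitance equation -/

/-- The difference of the two sides of the capacitance equation on the resonator `D_i^m`. -/
def rowDefect (m : ℤ) (i : Fin N) (t : ℝ) : ℂ :=
  P.b m i * (((P.δ * P.κr i / P.ρr i / G.len i : ℝ) : ℂ) *
      ((h.scaledMean t (resIndex m i) - h.scaledMean t (resIndex m i - 1)) /
          G.gapLen (resIndex m i - 1) -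
        (h.scaledMean t (resIndex m i + 1) - h.scaledMean t (resIndex m i)) /
          G.gapLen (resIndex m i))) +
    (1 / P.s i t : ℂ) * deriv (fun τ => (1 / P.κ i τ : ℂ) * deriv (h.mean (resIndex m i)) τ) t

omit h in
lemma inv_diagonal_ofReal {d : Fin N → ℝ} (hd : ∀ i, d i ≠ 0) :
    (Matrix.diagonal fun i => (d i : ℂ))⁻¹ = Matrix.diagonal fun i => (1 / d i : ℂ) := by
  refine Matrix.inv_eq_left_inv ?_
  rw [Matrix.diagonal_mul_diagonal, ← Matrix.diagonal_one]
  congr 1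
  ext i
  have : (d i : ℂ) ≠ 0 := by exact_mod_cast hd i
  field_simp

omit h in
lemma inv_S (t : ℝ) : (P.S t)⁻¹ = Matrix.diagonal fun i => (1 / P.s i t : ℂ) :=
  inv_diagonal_ofReal fun i => P.s_ne i t

omit h in
lemma inv_K (t : ℝ) : (P.K t)⁻¹ = Matrix.diagonal fun i => (1 / P.κ i t : ℂ) :=
  inv_diagonal_ofReal fun i => P.κ_ne i t

lemma differentiable_flux (p : ℤ) (i : Fin N) :
    Differentiable ℝ fun τ => (1 / P.κ i τ : ℂ) * deriv (h.mean p) τ := fun t =>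
  (h.differentiable_inv_κ i t).mul (h.hasDerivAt_deriv_mean p t).differentiableAt

/-- This lemma and `infDefect_eq` reduce the cell form and the infinite-matrix form to the same
scalar rows, so that a single estimate serves both. -/
lemma cellDefect_eq (m : ℤ) (t : ℝ) (i : Fin N) :
    cellDefect G P (cellVec G ω P.Ω u) m t i = h.rowDefect m i t := by
  have hsum : HasSum (fun n : ℤ => P.realCap G (n - m) *ᵥ ((P.S t)⁻¹ *ᵥ cellVec G ω P.Ω u n t))
      (fun j => ((P.δ * P.κr j / P.ρr j / G.len j : ℝ) : ℂ) *
        ((h.scaledMean t (resIndex m j) - h.scaledMean t (resIndex m j - 1)) /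
          G.gapLen (resIndex m j - 1) -
        (h.scaledMean t (resIndex m j + 1) - h.scaledMean t (resIndex m j)) /
          G.gapLen (resIndex m j))) := by
    rw [Pi.hasSum]
    intro j
    have := (hasSum_realCap G P m j (h.scaledMean t)).prod_fiberwise fun n => hasSum_fintype _
    refine Eq.mp (congrArg (HasSum · _) (funext fun n => ?_)) this
    rw [inv_S, Matrix.mulVec, dotProduct]
    refine Finset.sum_congr rfl fun k _ => ?_
    rw [Matrix.mulVec_diagonal, h.cellVec_eq_mean, scaledMean, G.posOf_resIndex]
  have hder : ∀ τ, deriv (cellVec G ω P.Ω u m) τ = fun j => deriv (h.mean (resIndex m j)) τ := by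
    intro τ
    refine HasDerivAt.deriv (hasDerivAt_pi.2 fun j => ?_)
    simp only [h.cellVec_eq_mean]
    exact (h.hasDerivAt_mean _ τ).differentiableAt.hasDerivAt
  have hder2 : deriv (fun τ => (P.K τ)⁻¹ *ᵥ deriv (cellVec G ω P.Ω u m) τ) t =
      fun j => deriv (fun τ => (1 / P.κ j τ : ℂ) * deriv (h.mean (resIndex m j)) τ) t := by
    refine HasDerivAt.deriv (hasDerivAt_pi.2 fun j => ?_)
    simp only [inv_K, Matrix.mulVec_diagonal, hder]
    exact (h.differentiable_flux _ j t).hasDerivAt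
  rw [cellDefect, hsum.tsum_eq, hder2, inv_S, Medium.B, Pi.add_apply, Matrix.mulVec_diagonal,
    Matrix.mulVec_diagonal, rowDefect]

omit h in
lemma infMulVec_blockDiag_diagonal (d : ℤ → Fin N → ℂ) (w : ℤ × Fin N → ℂ) (q : ℤ × Fin N) :
    infMulVec (blockDiag fun m => Matrix.diagonal (d m)) w q = d q.1 q.2 * w q := by
  rw [infMulVec, tsum_eq_single q]
  · simp [blockDiag]
  · rintro ⟨n, j⟩ hne
    obtain ⟨m, i⟩ := q
    simp only [blockDiag, Matrix.of_apply]
    split_ifs with h1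
    · rw [Matrix.diagonal_apply_ne _ (by rintro rfl; exact hne (by rw [h1])), zero_mul]
    · rw [zero_mul]

lemma infDefect_eq (m : ℤ) (t : ℝ) (i : Fin N) :
    infDefect G P (fun τ r => cellVec G ω P.Ω u r.1 τ r.2) t (m, i) = h.rowDefect m i t := by
  simp only [infDefect, Pi.add_apply, inv_S, inv_K]
  have hB : P.B = fun n => Matrix.diagonal fun j => (P.b n j : ℂ) := rfl
  rw [hB, infMulVec_blockDiag_diagonal, infMulVec_blockDiag_diagonal]
  simp only [infMulVec_blockDiag_diagonal, h.cellVec_eq_mean]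
  rw [rowDefect]
  congr 2
  rw [← (hasSum_realCap G P m i (h.scaledMean t)).tsum_eq, infMulVec]
  refine tsum_congr fun q => ?_
  rw [infMulVec_blockDiag_diagonal, scaledMean, G.posOf_resIndex]
  rfl

/-- Integration of the interior equation over a resonator. -/
lemma deriv_flux_eq (p : ℤ) (t : ℝ) :
    deriv (fun τ => (1 / P.κ (G.posOf p) τ : ℂ) * deriv (h.mean p) τ) t =
      ((G.xp p - G.xm p)⁻¹ : ℝ) * ((P.vd (G.cellOf p) (G.posOf p) : ℂ) ^ 2 *
        (deriv (fun y => h.sol.resExt p (y, t)) (G.xp p) -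
          deriv (fun y => h.sol.resExt p (y, t)) (G.xm p))) := by
  have hU := h.sol.contDiff_resExt p
  have hU1 := h.contDiff_partialTime_resExt p
  have hc1 := hU1.continuous
  have hc2 : Continuous (partialTime (partialTime (h.sol.resExt p))) :=
    (contDiff_partialTime (n := 0) (by norm_num; exact hU1)).continuous
  have hs : ContDiff ℝ 1 (deriv fun y => h.sol.resExt p (y, t)) := by
    have h2 : ContDiff ℝ (1 + 1) fun y => h.sol.resExt p (y, t) := by
      simpa [one_add_one_eq_two] using contDiff_sliceSpace hU t
    exact (contDiff_succ_iff_deriv.1 h2).2.2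
  rw [← intervalIntegral.integral_deriv_eq_sub
    (fun z _ => (hs.differentiable one_ne_zero) z)
    ((hs.continuous_deriv le_rfl).intervalIntegrable _ _),
    ← intervalIntegral.integral_const_mul,
    ← intervalIntegral.integral_congr_Ioo_of_le (G.lt_resonator p).le
      (fun x hx => h.sol.resExt_wave h.differentiable_inv_κ p hx t),
    intervalIntegral.integral_add (Continuous.intervalIntegrable (by fun_prop) _ _)
      (Continuous.intervalIntegrable (by fun_prop) _ _),
    intervalIntegral.integral_const_mul, intervalIntegral.integral_const_mul]
  refine ((h.differentiable_inv_κ (G.posOf p) t).hasDerivAt.mul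
    (h.hasDerivAt_deriv_mean p t)).deriv.trans ?_
  rw [(h.hasDerivAt_mean p t).deriv]
  ring

/-- Two cancellations: b_i^m δ (v_i)²/ℓ_i = δ^m (v_i^m)²/ℓ_i by definition of b_i^m, and 1/s_i
removes the s_i of the flux condition. Difference quotients and exterior derivatives thus carry the
same coefficient, and only their differences remain. -/
lemma rowDefect_eq (m : ℤ) (i : Fin N) (t : ℝ) (p : ℤ) (hp : resIndex m i = p + 1) :
    h.rowDefect m i t = ((P.δd m * P.vd m i ^ 2 / G.len i : ℝ) : ℂ) *
      (((h.scaledMean t (p + 1) - h.scaledMean t p) / G.gapLen p -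
          deriv (fun y => h.sol.gapExt p (y, t)) (G.xm (p + 1))) -
        ((h.scaledMean t (p + 1 + 1) - h.scaledMean t (p + 1)) / G.gapLen (p + 1) -
          deriv (fun y => h.sol.gapExt (p + 1) (y, t)) (G.xp (p + 1)))) := by
  have hc : G.cellOf (p + 1) = m := by rw [← hp, G.cellOf_resIndex]
  have hi : G.posOf (p + 1) = i := by rw [← hp, G.posOf_resIndex]
  have hl : G.xp (p + 1) - G.xm (p + 1) = G.len i := by rw [← hp]; exact G.len_eq m i
  have hf := h.deriv_flux_eq (p + 1) t
  rw [h.sol.deriv_resExt_right, h.sol.deriv_resExt_left, hc, hi, hl] at hf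
  rw [rowDefect, hp, hf, add_sub_cancel_right]
  have hb : (P.b m i : ℂ) * ((P.δ * P.κr i / P.ρr i / G.len i : ℝ) : ℂ) =
      ((P.δd m * P.vd m i ^ 2 / G.len i : ℝ) : ℂ) := by
    rw [← Complex.ofReal_mul]
    congr 1
    have h1 : P.vr i ^ 2 = P.κr i / P.ρr i :=
      Real.sq_sqrt (div_pos (P.κr_pos i) (P.ρr_pos i)).le
    rw [Medium.b, h1]
    have := P.δ_pos.ne'
    have := (P.κr_pos i).ne'
    have := (P.ρr_pos i).ne'
    have := (G.len_pos i).ne'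
    field_simp
  rw [← mul_assoc, hb]
  have hs : (P.s i t : ℂ) ≠ 0 := by exact_mod_cast P.s_ne i t
  have hl' : (G.len i : ℂ) ≠ 0 := by exact_mod_cast (G.len_pos i).ne'
  push_cast
  field_simp
  ring

/-- The constant in the bound of the defect. -/
def defectConst (G : ResonatorArray N) (g l Λ : ℝ) : ℝ := Λ ^ 3 / l * (2 * slopeConst G g Λ)

lemma norm_rowDefect_le {g l : ℝ} (hg : 0 < g) (hgap : ∀ p, g ≤ G.gapLen p) (hl : 0 < l)
    (hlen : ∀ i, l ≤ G.len i) (m : ℤ) (i : Fin N) (t : ℝ) :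
    ‖h.rowDefect m i t‖ ≤ defectConst G g l Λ * P.δ *
      (mass G P γ ω u t (resIndex m i - 2) + mass G P γ ω u t (resIndex m i - 1) +
        mass G P γ ω u t (resIndex m i)) := by
  obtain ⟨p, hp⟩ : ∃ p, resIndex m i = p + 1 := ⟨resIndex m i - 1, by ring⟩
  have hΛ := h.Λ_pos
  have hδ := P.δ_pos
  have hL := G.L_pos
  have hS : 0 ≤ slopeConst G g Λ := by
    unfold slopeConst resConst gapConst; positivity
  have m0 := mass_nonneg (G := G) (P := P) (γ := γ) (ω := ω) (u := u) t (p - 1)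
  have m1 := mass_nonneg (G := G) (P := P) (γ := γ) (ω := ω) (u := u) t p
  have m2 := mass_nonneg (G := G) (P := P) (γ := γ) (ω := ω) (u := u) t (p + 1)
  rw [h.rowDefect_eq m i t p hp, hp, norm_mul, Complex.norm_real, Real.norm_eq_abs,
    show p + 1 - 2 = p - 1 by ring, add_sub_cancel_right]
  have h1 := h.norm_scaledMean_slope_le hg hgap p t (Set.right_mem_Icc.2 (G.lt_gap p).le)
  have h2 := h.norm_scaledMean_slope_le hg hgap (p + 1) t
    (Set.left_mem_Icc.2 (G.lt_gap (p + 1)).le)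
  rw [add_sub_cancel_right] at h2
  have hcoef : |P.δd m * P.vd m i ^ 2 / G.len i| ≤ Λ ^ 3 / l * P.δ := by
    have hδd := P.δd_pos m
    have hli := G.len_pos i
    have hv : 0 ≤ P.vd m i := Real.sqrt_nonneg _
    rw [abs_of_nonneg (by positivity)]
    calc _ ≤ (Λ * P.δ) * Λ ^ 2 / l := by
          have := h.regime.δd_upper m
          have := h.regime.vd_upper m i
          have := hlen i
          gcongr
      _ = _ := by ring
  calc _ ≤ (Λ ^ 3 / l * P.δ) * (slopeConst G g Λ *
        (mass G P γ ω u t (p - 1) + mass G P γ ω u t p) +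
        slopeConst G g Λ * (mass G P γ ω u t p + mass G P γ ω u t (p + 1))) := by
        gcongr
        exact (norm_sub_le _ _).trans (add_le_add h1 h2)
    _ ≤ (Λ ^ 3 / l * P.δ) * (2 * slopeConst G g Λ *
        (mass G P γ ω u t (p - 1) + mass G P γ ω u t p + mass G P γ ω u t (p + 1))) := by
        gcongr
        nlinarith
    _ = _ := by rw [defectConst]; ring

lemma mass_le (t : ℝ) (q : ℤ) : mass G P γ ω u t q ≤
    √G.L * majorantConst Λ * P.smallness γ * (Real.exp (-(ω.im * t)) * totalNorm ω P.Ω u) := by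
  rw [mass]
  calc _ ≤ Real.exp (-(ω.im * t)) *
        (√G.L * (majorantConst Λ * P.smallness γ * totalNorm ω P.Ω u)) := by
        gcongr
        exact h.cellMass_le q
    _ = _ := by ring

lemma mass_sq_tsum_le (t : ℝ) : (Summable fun q => mass G P γ ω u t q ^ 2) ∧
    ∑' q, mass G P γ ω u t q ^ 2 ≤ (√G.L * majorantConst Λ * P.smallness γ *
      (Real.exp (-(ω.im * t)) * totalNorm ω P.Ω u)) ^ 2 := by
  obtain ⟨h1, h2⟩ := h.cellMass_sq_tsum_le
  simp only [mass, mul_pow]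
  refine ⟨h1.mul_left _, ?_⟩
  rw [tsum_mul_left, Real.sq_sqrt G.L_pos.le]
  calc _ ≤ Real.exp (-(ω.im * t)) ^ 2 *
        (G.L * (majorantConst Λ * P.smallness γ * totalNorm ω P.Ω u) ^ 2) := by gcongr
    _ = _ := by ring

lemma rowDefect_sq_tsum_le {g l : ℝ} (hg : 0 < g) (hgap : ∀ p, g ≤ G.gapLen p) (hl : 0 < l)
    (hlen : ∀ i, l ≤ G.len i) (t : ℝ) :
    (Summable fun q : ℤ × Fin N => ‖h.rowDefect q.1 q.2 t‖ ^ 2) ∧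
    ∑' q : ℤ × Fin N, ‖h.rowDefect q.1 q.2 t‖ ^ 2 ≤
      (3 * defectConst G g l Λ * P.δ * (√G.L * majorantConst Λ * P.smallness γ *
        (Real.exp (-(ω.im * t)) * totalNorm ω P.Ω u))) ^ 2 := by
  obtain ⟨hs, hle⟩ := h.mass_sq_tsum_le t
  have := tsum_sq_le_of_le_three_term (resEquiv N G.N_pos)
    (fun q => norm_nonneg (h.rowDefect q.1 q.2 t))
    (fun q => h.norm_rowDefect_le hg hgap hl hlen q.1 q.2 t) hs hle
  rwa [← mul_assoc 3] at this

end SubwavelengthSolution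

/-! ### Choice of the constant and conclusion. -/

open SubwavelengthSolution in
theorem mainTheorem5 {N : ℕ} (G : ResonatorArray N) (Λ γ : ℝ) (hΛ : 0 < Λ)
    (hγ : γ ∈ Set.Ioo (0 : ℝ) 1) :
    ∃ A : ℝ, 0 < A ∧
      ∀ (P : Medium N) (M : ℕ) (ω : ℂ) (u : ℝ → ℝ → ℂ),
        P.δ < 1 → P.InRegime Λ γ M →
        IsWaveSolution G P u → HasQuasifrequency ω P.Ω u → IsLocalised ω P.Ω u →
        IsSubwavelength Λ γ P.δ M ω P.Ω u →
        -- the Fourier series of the cell vectors converge to twice differentiable functions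
        (∀ m : ℤ, Summable (fun k : ℤ => ‖modeVec G ω P.Ω u k m‖) ∧
          ContDiff ℝ 2 (cellVec G ω P.Ω u m)) ∧
        -- the cell vectors are the leading-order constant values of `u` in the resonators
        (∀ (m : ℤ) (i : Fin N), ∀ x ∈ Set.Ioo (G.left m i) (G.right m i), ∀ t : ℝ,
          ‖u x t - cellVec G ω P.Ω u m t i‖
            ≤ A * P.δ ^ ((1 - γ) / 2) * (Real.exp (-(ω.im * t)) * totalNorm ω P.Ω u)) ∧
        -- the real-space capacitance equation in every cell, at leading order
        (∀ (m : ℤ) (t : ℝ),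
          ‖cellDefect G P (cellVec G ω P.Ω u) m t‖
            ≤ A * P.δ ^ (1 + (1 - γ) / 2) * (Real.exp (-(ω.im * t)) * totalNorm ω P.Ω u)) ∧
        -- the infinite-matrix form, at leading order in `ℓ²`
        (∀ t : ℝ,
          Summable (fun q : ℤ × Fin N =>
            ‖infDefect G P (fun τ r => cellVec G ω P.Ω u r.1 τ r.2) t q‖ ^ 2) ∧
          √(∑' q : ℤ × Fin N,
              ‖infDefect G P (fun τ r => cellVec G ω P.Ω u r.1 τ r.2) t q‖ ^ 2)
            ≤ A * P.δ ^ (1 + (1 - γ) / 2) *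
              (Real.exp (-(ω.im * t)) * totalNorm ω P.Ω u)) := by
  -- The constants g and l depend on the array only and are fixed before the medium and the
  -- solution.
  obtain ⟨g, hg, hgap⟩ := G.exists_gapLen_lower
  obtain ⟨l, hl, hlen⟩ := G.exists_len_lower
  have hL := G.L_pos
  have hC : 0 < majorantConst Λ := by unfold majorantConst; positivity
  have hR : 0 < resConst g Λ := by unfold resConst gapConst; positivity
  have hD : 0 < defectConst G g l Λ := by
    unfold defectConst slopeConst; positivity
  -- A₁ serves the distance of u from its mean, A₂ the defect; the 3 counts the masses in a row, and
  -- √L times `majorantConst` comes from the bound of one mass.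
  set A₁ := G.L * resConst g Λ * (√G.L * majorantConst Λ) with hA₁
  set A₂ := 3 * defectConst G g l Λ * (√G.L * majorantConst Λ) with hA₂
  have hp₁ : 0 < A₁ := by positivity
  have hp₂ : 0 < A₂ := by positivity
  refine ⟨A₁ + A₂, by positivity, fun P M ω u hδ hreg hsol hq hloc hsub => ?_⟩
  have h : SubwavelengthSolution G P Λ γ M ω u := ⟨hΛ, hγ, hδ, hreg, hsol, hq, hloc, hsub⟩
  have hδ0 := P.δ_pos
  have hT := h.totalNorm_nonneg
  have hη := h.smallness_pos
  -- The power splits into δ, from the contrast in front of the defect, and η, from the masses.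
  have hpow : P.δ ^ (1 + (1 - γ) / 2) = P.δ * P.smallness γ := by
    rw [Real.rpow_add hδ0, Real.rpow_one, Medium.smallness]
  refine ⟨fun m => ⟨h.summable_norm_modeVec m, h.contDiff_cellVec m⟩, ?_, ?_, ?_⟩
  · intro m i x hx t
    obtain ⟨p, hp⟩ : ∃ p, resIndex m i = p + 1 := ⟨resIndex m i - 1, by ring⟩
    rw [ResonatorArray.left, ResonatorArray.right, hp] at hx
    rw [h.cellVec_eq_mean, hp, h.sol.eq_resExt (p + 1) x hx t]
    refine (h.norm_resExt_sub_mean_le hg hgap p t ⟨hx.1.le, hx.2.le⟩).trans ?_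
    set E := Real.exp (-(ω.im * t)) * totalNorm ω P.Ω u with hE
    have hE0 : 0 ≤ E := by positivity
    calc _ ≤ G.L * resConst g Λ * (√G.L * majorantConst Λ * P.smallness γ * E) := by
          have := h.mass_le t p
          gcongr
      _ = A₁ * P.smallness γ * E := by rw [hA₁]; ring
      _ ≤ (A₁ + A₂) * P.smallness γ * E := by gcongr; linarith
  · intro m t
    set E := Real.exp (-(ω.im * t)) * totalNorm ω P.Ω u with hE
    have hE0 : 0 ≤ E := by positivity
    rw [hpow, pi_norm_le_iff_of_nonneg (by positivity)]
    intro i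
    rw [h.cellDefect_eq]
    refine (h.norm_rowDefect_le hg hgap hl hlen m i t).trans ?_
    calc _ ≤ defectConst G g l Λ * P.δ * (√G.L * majorantConst Λ * P.smallness γ * E +
          √G.L * majorantConst Λ * P.smallness γ * E +
          √G.L * majorantConst Λ * P.smallness γ * E) := by
          have := fun q => h.mass_le t q
          gcongr <;> apply this
      _ = A₂ * (P.δ * P.smallness γ) * E := by rw [hA₂]; ring
      _ ≤ (A₁ + A₂) * (P.δ * P.smallness γ) * E := by gcongr; linarith
  · intro t
    obtain ⟨hs, hle⟩ := h.rowDefect_sq_tsum_le hg hgap hl hlen t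
    have e : ∀ q : ℤ × Fin N, infDefect G P (fun τ r => cellVec G ω P.Ω u r.1 τ r.2) t q =
        h.rowDefect q.1 q.2 t := fun q => h.infDefect_eq q.1 t q.2
    simp only [e]
    refine ⟨hs, ?_⟩
    set E := Real.exp (-(ω.im * t)) * totalNorm ω P.Ω u with hE
    have hE0 : 0 ≤ E := by positivity
    rw [hpow]
    refine (Real.sqrt_le_left (by positivity)).2 (hle.trans ?_)
    refine pow_le_pow_left₀ (by positivity) ?_ 2
    calc _ = A₂ * (P.δ * P.smallness γ) * E := by rw [hA₂]; ring
      _ ≤ (A₁ + A₂) * (P.δ * P.smallness γ) * E := by gcongr; linarith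

end
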